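/- Let $A_0 \in M_2(\mathbb{C})$ and let $A = A_0$ or $A = A_0 \oplus [\mu]$ with $\mu \in \mathbb{C}$. Let $B \in \mathcal{B}(\mathcal{H})$ be a bounded linear operator on a complex Hilbert space $\mathcal{H}$, and let $\mathcal{S} = \operatorname{span}\{I, A, A^*\}$. (a) Suppose that $$\Phi(aI + bA + cA^*) = aI + bB + cB^* \qquad (a, b, c \in \mathbb{C})$$ defines a (necessarily unital) linear map $\Phi : \mathcal{S} \to \mathcal{B}(\mathcal{H})$. Then $\Phi$ is positive if and only if $\Phi$ is completely positive. Here $\Phi$ is *positive* if it maps positive semidefinite elements of $\mathcal{S}$ to positive semidefinite operators, and *completely positive* if for every $k \ge 1$ the map $(T_{ij}) \mapsto (\Phi(T_{ij}))$ from $M_k(\mathcal{S})$ to $M_k(\mathcal{B}(\mathcal{H}))$ is positive. (b) If $W(B) \subseteq W(A)$, where $W(T) = \{\langle Tx, x\rangle : \|x\| = 1\}$ denotes the numerical range, then $B$ has a dilation of the form $I \otimes A$: there are a complex Hilbert space $\mathcal{K}_1$ and an isometry $X : \mathcal{H} \to \mathcal{K}_1 \otimes \mathbb{C}^n$ ($n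 = 2$ or $3$ being the size of $A$) with $X^*(I_{\mathcal{K}_1} \otimes A)X = B$. -/

import Mathlib

open scoped TensorProduct

namespace NumericalRangeDilation

universe u v

section Operators

variable {K : Type v} [NormedAddCommGroup K] [InnerProductSpace ℂ K]
variable {H : Type u} [NormedAddCommGroup H] [InnerProductSpace ℂ H]

/-- The numerical range `W(T)`. Mathlib's inner product is conjugate linear in the first slot,
so `inner ℂ x (T x)` is the number usually written `⟨T x, x⟩`. -/
def numericalRange (T : K →L[ℂ] K) : Set ℂ :=
  {z | ∃ x : K, ‖x‖ = 1 ∧ inner ℂ x (T x) = z}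

/-- The bounded operator on the Hilbert direct sum `K ⊕ ⋯ ⊕ K` (`k` copies) that is given by a
`k × k` matrix of bounded operators on `K`. -/
noncomputable def blockOp {k : ℕ} (T : Matrix (Fin k) (Fin k) (K →L[ℂ] K)) :
    PiLp 2 (fun _ : Fin k => K) →L[ℂ] PiLp 2 (fun _ : Fin k => K) :=
  ((PiLp.continuousLinearEquiv 2 ℂ (fun _ : Fin k => K)).symm :
      (Fin k → K) →L[ℂ] PiLp 2 (fun _ : Fin k => K)) ∘L
    ContinuousLinearMap.pi fun i => ∑ j, T i j ∘L PiLp.proj 2 (fun _ : Fin k => K) j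

theorem blockOp_apply {k : ℕ} (T : Matrix (Fin k) (Fin k) (K →L[ℂ] K))
    (x : PiLp 2 (fun _ : Fin k => K)) (i : Fin k) :
    blockOp T x i = ∑ j, T i j (x j) := by
  simp [blockOp]

/-- A linear map on a subspace `S` of `B(K)` is positive if it sends the positive semidefinite
operators in `S` to positive semidefinite operators. -/
def IsPositiveMap {S : Submodule ℂ (K →L[ℂ] K)} (Φ : S →ₗ[ℂ] (H →L[ℂ] H)) : Prop :=
  ∀ T : S, (T : K →L[ℂ] K).IsPositive → (Φ T).IsPositive

/-- A linear map on a subspace `S` of `B(K)` is completely positive if, for every `k`, its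
entrywise application `M_k(S) → M_k(B(H))` is positive, where a matrix of operators is seen as
an operator on the direct sum of `k` copies of the space. -/
def IsCompletelyPositiveMap {S : Submodule ℂ (K →L[ℂ] K)} (Φ : S →ₗ[ℂ] (H →L[ℂ] H)) : Prop :=
  ∀ (k : ℕ) (T : Matrix (Fin k) (Fin k) S),
    (blockOp (T.map fun s => (s : K →L[ℂ] K))).IsPositive → (blockOp (T.map Φ)).IsPositive

/-- The operator system `span {I, A, A*}`. -/
def opSystem [CompleteSpace K] (A : K →L[ℂ] K) : Submodule ℂ (K →L[ℂ] K) :=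
  Submodule.span ℂ {1, A, ContinuousLinearMap.adjoint A}

theorem combination_mem_opSystem [CompleteSpace K] (A : K →L[ℂ] K) (a b c : ℂ) :
    a • (1 : K →L[ℂ] K) + b • A + c • ContinuousLinearMap.adjoint A ∈ opSystem A := by
  refine add_mem (add_mem ?_ ?_) ?_ <;>
    exact Submodule.smul_mem _ _ (Submodule.subset_span (by simp))

/-- `Φ` is the linear map `a I + b A + c A* ↦ a I + b B + c B*` on `span {I, A, A*}`. -/
def IsCanonicalMap [CompleteSpace K] [CompleteSpace H] (A : K →L[ℂ] K) (B : H →L[ℂ] H)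
    (Φ : opSystem A →ₗ[ℂ] (H →L[ℂ] H)) : Prop :=
  ∀ a b c : ℂ,
    Φ ⟨a • (1 : K →L[ℂ] K) + b • A + c • ContinuousLinearMap.adjoint A,
        combination_mem_opSystem A a b c⟩ =
      a • (1 : H →L[ℂ] H) + b • B + c • ContinuousLinearMap.adjoint B

/-- `B` has a dilation of the form `I ⊗ A`: there are a Hilbert space `K₁` and an isometry
`X : H → K₁ ⊗ K` with `X* (I ⊗ A) X = B`, the last equation being written through inner products.
As `K` has finite dimension, the algebraic tensor product is the Hilbert space tensor product. -/
def HasTensorDilation [FiniteDimensional ℂ K] (A : K →L[ℂ] K) (B : H →L[ℂ] H) : Prop :=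
  ∃ (K₁ : Type u) (_ : NormedAddCommGroup K₁) (_ : InnerProductSpace ℂ K₁) (_ : CompleteSpace K₁)
    (X : H →ₗᵢ[ℂ] K₁ ⊗[ℂ] K),
    ∀ x y : H, inner ℂ (X x) (A.lTensor K₁ (X y)) = inner ℂ x (B y)

end Operators

/-- The operator on the Euclidean space `ℂⁿ` given by a square matrix. -/
noncomputable abbrev matOp {n : Type} [Fintype n] [DecidableEq n] (A : Matrix n n ℂ) :
    EuclideanSpace ℂ n →L[ℂ] EuclideanSpace ℂ n :=
  Matrix.toEuclideanCLM (𝕜 := ℂ) A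

/-- The `3 × 3` matrix `A₀ ⊕ [μ]`. -/
def directSumScalar (A₀ : Matrix (Fin 2) (Fin 2) ℂ) (μ : ℂ) :
    Matrix (Fin 2 ⊕ Fin 1) (Fin 2 ⊕ Fin 1) ℂ :=
  Matrix.fromBlocks A₀ 0 0 !![μ]

end NumericalRangeDilation

open NumericalRangeDilation

/-! Both hypotheses, positivity of `Φ` and `W(B) ⊆ W(A)`, yield `FormDominated`: a real affine
function `a + 2 Re (b ·)` whose form is nonnegative at `A` has a nonnegative form at `B`. Both
conclusions follow from `HasCoordinateDilation`: operators `X i` with `∑ (X i)* (X i) = I` and `∑ A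
i j (X i)* (X j) = B`. The core is that the former implies the latter for the given shapes of `A`.

Up to a unitary, `A₀` is diagonal or a nonnormal symmetric matrix
(`exists_unitary_diagonal_or_symmetric`). If it is diagonal, `B` is handled through barycentric
coordinates on a segment or triangle: these are positive operators, and their square roots are the
`X i`.

If it is symmetric and nonnormal, the affine real parts of `A₀` are exactly the real symmetric `2 ×
2` matrices. Applying to `B` the affine functions that produce `E₁₁`, `E₁₂ + E₂₁`, `E₂₂` from `A₀`
gives operators `c`, `b`, `a`; since `s² E₁₁ + s t (E₁₂ + E₂₁) + t² E₂₂` is positive, so is `s² c +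
s t b + t² a`. A factorization `(s Z₀ + t Z₁)* (s Z₀ + t Z₁)` of this pencil is a dilation. With a
summand `[μ]`, positivity is known only where the value at `μ`, a scalar quadratic form in `s, t` of
trace one, is nonnegative; an operator S-lemma (`hasQuadraticFactorization_of_trace_eq_one`) then
adds a term (value at `μ`) `Y* Y`, and `Y` is the third coordinate.

Both factorizations come from the operator Fejér-Riesz theorem in degree two (`exists_fejer_riesz`).
-/

section FejerRiesz

/-! ### Factorization from an isometry. -/

/-- The distance to a subspace of a seminormed inner product space is the norm of the component
orthogonal to the closure of that subspace in the completion. -/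
theorem norm_sub_starProjection_completion {V : Type*} [SeminormedAddCommGroup V]
    [InnerProductSpace ℂ V] (M : Submodule ℂ V)
    [(M.map (UniformSpace.Completion.toComplₗᵢ (𝕜 := ℂ) (E := V)).toLinearMap).topologicalClosure.HasOrthogonalProjection]
    (v : V) :
    ‖(v : UniformSpace.Completion V) - (M.map (UniformSpace.Completion.toComplₗᵢ (𝕜 := ℂ)
      (E := V)).toLinearMap).topologicalClosure.starProjection v‖ = Metric.infDist v (M : Set V) := by
  rw [Submodule.starProjection_minimal]
  simp only [← dist_eq_norm]
  refine (Metric.infDist_eq_iInf (s := ((M.map (UniformSpace.Completion.toComplₗᵢ (𝕜 := ℂ)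
      (E := V)).toLinearMap).topologicalClosure : Set (UniformSpace.Completion V)))).symm.trans ?_
  rw [Submodule.topologicalClosure_coe, Metric.infDist_closure]
  exact Metric.infDist_image (UniformSpace.Completion.toComplₗᵢ (𝕜 := ℂ) (E := V)).isometry

/-- An isometry `U` of a semi-inner product space whose third power maps into the orthogonal
complement of the range of `δ` yields an operator Fejér-Riesz factorization of degree two. -/
theorem exists_factorization_of_isometry {H V : Type*} [NormedAddCommGroup H]
    [InnerProductSpace ℂ H] [SeminormedAddCommGroup V] [InnerProductSpace ℂ V]
    (U : V →ₗᵢ[ℂ] V) (δ : H →L[ℂ] V) (hδ : ∀ h x, inner ℂ (δ h) (U (U (U x))) = 0) :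
    ∃ X₀ X₁ X₂ : H →L[ℂ] UniformSpace.Completion V, ∀ (z : ℂ) (h : H), ‖z‖ = 1 →
      ‖X₀ h + z • X₁ h + z ^ 2 • X₂ h‖ ^ 2 = ‖δ h‖ ^ 2 + 2 * (inner ℂ (δ h) (z • U (δ h))).re +
        2 * (inner ℂ (δ h) (z ^ 2 • U (U (δ h)))).re := by
  let ι := (UniformSpace.Completion.toComplₗᵢ (𝕜 := ℂ) (E := V))
  let M₂ : Submodule ℂ V := LinearMap.range (U.toLinearMap ∘ₗ U.toLinearMap)
  let M₃ : Submodule ℂ V := M₂.map U.toLinearMap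
  let N₂ := (M₂.map ι.toLinearMap).topologicalClosure
  let N₃ := (M₃.map ι.toLinearMap).topologicalClosure
  have hM : M₃ ≤ M₂ := by
    rintro _ ⟨_, ⟨x, rfl⟩, rfl⟩
    exact ⟨U x, rfl⟩
  have hN : N₃ ≤ N₂ := Submodule.topologicalClosure_mono (Submodule.map_mono hM)
  let ι' : V →L[ℂ] UniformSpace.Completion V := ι.toContinuousLinearMap
  let U' : V →L[ℂ] V := U.toContinuousLinearMap
  -- With `M₂ = ran U²` and `M₃ = ran U³`, `D` projects onto the orthogonal complement of `N₃` in
  -- `N₂`, and the factors are `D U^j δ`. Then `‖D w‖²` is a difference of squared distances from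
  -- `w` to `N₃` and `N₂`, and the unknown distance from `v` to `N₂` cancels.
  let D := N₂.starProjection - N₃.starProjection
  have hι : ∀ v : V, ι' v = (v : UniformSpace.Completion V) := fun v => rfl
  have hδ₃ : ∀ h, N₃.starProjection (ι' (δ h)) = 0 := by
    intro h
    rw [Submodule.starProjection_apply_eq_zero_iff]
    rw [Submodule.orthogonal_closure]
    rintro _ ⟨_, ⟨_, ⟨x, rfl⟩, rfl⟩, rfl⟩
    refine (ι.inner_map_map _ _).trans ?_
    rw [← inner_conj_symm]
    exact (congrArg _ (hδ h x)).trans (map_zero _)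
  refine ⟨D ∘L ι' ∘L δ, D ∘L ι' ∘L U' ∘L δ, D ∘L ι' ∘L U' ∘L U' ∘L δ, fun z h hz => ?_⟩
  let v := δ h + z • U (δ h)
  let w := v + z ^ 2 • U (U (δ h))
  have h1 : (D ∘L ι' ∘L δ) h + z • (D ∘L ι' ∘L U' ∘L δ) h +
      z ^ 2 • (D ∘L ι' ∘L U' ∘L U' ∘L δ) h = N₂.starProjection (ι' w) - N₃.starProjection (ι' w) := by
    simp only [w, v, map_add, map_smul, D, ContinuousLinearMap.comp_apply,
      sub_apply, smul_sub, U', LinearIsometry.coe_toContinuousLinearMap]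
    abel
  have h2 : ‖N₂.starProjection (ι' w) - N₃.starProjection (ι' w)‖ ^ 2 =
      ‖ι' w - N₃.starProjection (ι' w)‖ ^ 2 - ‖ι' w - N₂.starProjection (ι' w)‖ ^ 2 := by
    have e : ι' w - N₃.starProjection (ι' w) = (ι' w - N₂.starProjection (ι' w)) +
      (N₂.starProjection (ι' w) - N₃.starProjection (ι' w)) := by abel
    have o : inner ℂ (ι' w - N₂.starProjection (ι' w))
        (N₂.starProjection (ι' w) - N₃.starProjection (ι' w)) = 0 := by
      refine Submodule.starProjection_inner_eq_zero _ _ ?_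
      exact sub_mem (Submodule.starProjection_apply_mem _ _)
        (hN (Submodule.starProjection_apply_mem _ _))
    have := norm_add_sq_eq_norm_sq_add_norm_sq_of_inner_eq_zero _ _ o
    rw [e, sq ‖_ + _‖, this]; ring
  have h3 : ι' w - N₂.starProjection (ι' w) = ι' v - N₂.starProjection (ι' v) := by
    have : N₂.starProjection (ι' (U (U (δ h)))) = ι' (U (U (δ h))) := by
      rw [Submodule.starProjection_eq_self_iff]
      exact Submodule.le_topologicalClosure _ ⟨_, ⟨δ h, rfl⟩, rfl⟩
    simp only [w, map_add, map_smul, this]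
    abel
  -- `M₃ = U M₂`, so `U` preserves this distance. It is computed in `V` itself, so `U` need not be
  -- extended to the completion.
  have h4 : ‖ι' (U v) - N₃.starProjection (ι' (U v))‖ = ‖ι' v - N₂.starProjection (ι' v)‖ := by
    rw [hι, hι]
    refine (norm_sub_starProjection_completion M₃ (U v)).trans
      (Eq.trans ?_ (norm_sub_starProjection_completion M₂ v).symm)
    exact Metric.infDist_image U.isometry
  have h5 : ι' w - N₃.starProjection (ι' w) =
      ι' (δ h) + z • (ι' (U v) - N₃.starProjection (ι' (U v))) := by
    have : w = δ h + z • U v := by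
      simp only [w, v, map_add, map_smul, smul_add, smul_smul, sq]; abel
    rw [this]
    simp only [map_add, map_smul, hδ₃, smul_sub]; abel
  have h6 : (inner ℂ (ι' (δ h)) (z • (ι' (U v) - N₃.starProjection (ι' (U v))))).re =
      (inner ℂ (δ h) (z • U (δ h))).re + (inner ℂ (δ h) (z ^ 2 • U (U (δ h)))).re := by
    have e1 : inner ℂ (ι' (δ h)) (N₃.starProjection (ι' (U v))) = 0 := by
      rw [← Submodule.inner_starProjection_left_eq_right, hδ₃, inner_zero_left]
    have e2 : inner ℂ (ι' (δ h)) (ι' (U v)) = inner ℂ (δ h) (U v) := ι.inner_map_map _ _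
    rw [inner_smul_right, inner_sub_right, e1, e2, sub_zero, ← inner_smul_right, ← Complex.add_re,
      ← inner_add_right]
    simp only [v, map_add, map_smul, smul_add, smul_smul, sq]
  have h7 : ‖ι' (δ h)‖ = ‖δ h‖ := ι.norm_map _
  rw [h1, h2, h3, h5, @norm_add_sq ℂ, norm_smul, hz, one_mul, h4, h7]
  simp only [RCLike.re_eq_complex_re, h6]
  ring

end FejerRiesz

/-! ### The mean over the circle of an operator trigonometric polynomial. -/

section TrigonometricForm

open Complex

/-- The character `θ ↦ exp (i k θ)`. -/
noncomputable def circleChar (k : ℤ) (θ : ℝ) : ℂ := cexp (k * θ * I)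

theorem circleChar_mul (k l : ℤ) (θ : ℝ) :
    circleChar k θ * circleChar l θ = circleChar (k + l) θ := by
  rw [circleChar, circleChar, circleChar, ← Complex.exp_add]
  push_cast; ring_nf

theorem conj_circleChar (k : ℤ) (θ : ℝ) :
    (starRingEnd ℂ) (circleChar k θ) = circleChar (-k) θ := by
  rw [circleChar, circleChar, ← Complex.exp_conj]
  simp

theorem norm_circleChar (k : ℤ) (θ : ℝ) : ‖circleChar k θ‖ = 1 := by
  rw [circleChar]
  exact_mod_cast Complex.norm_exp_ofReal_mul_I (k * θ)

@[fun_prop]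
theorem continuous_circleChar (k : ℤ) : Continuous (circleChar k) := by
  unfold circleChar; fun_prop

theorem integral_circleChar (k : ℤ) :
    ∫ θ in (0 : ℝ)..(2 * Real.pi), circleChar k θ = if k = 0 then (2 * Real.pi : ℂ) else 0 := by
  split_ifs with h
  · simp [h, circleChar]
  · have hk : (k * I : ℂ) ≠ 0 := by simp [h]
    have : ∀ θ : ℝ, circleChar k θ = cexp (k * I * θ) := fun θ => by
      rw [circleChar]; ring_nf
    simp only [this]
    rw [integral_exp_mul_complex hk]
    have : (k * I * ((2 * Real.pi : ℝ) : ℂ)) = k * (2 * Real.pi * I) := by push_cast; ring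
    rw [this, Complex.exp_int_mul_two_pi_mul_I]
    simp

variable {H : Type*} [NormedAddCommGroup H] [InnerProductSpace ℂ H]

/-- The sesquilinear form of the operator trigonometric polynomial
`P + exp(iθ) Q₁ + exp(-iθ) Q₁* + exp(2iθ) Q₂ + exp(-2iθ) Q₂*`. -/
noncomputable def trigForm (P Q₁ Q₂ : H →L[ℂ] H) (θ : ℝ) (x y : H) : ℂ :=
  inner ℂ x (P y) + circleChar 1 θ * inner ℂ x (Q₁ y) + circleChar (-1) θ * inner ℂ (Q₁ x) y +
    circleChar 2 θ * inner ℂ x (Q₂ y) + circleChar (-2) θ * inner ℂ (Q₂ x) y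

/-- The value at `exp (-iθ)` of a polynomial with coefficients in `H`. -/
noncomputable def trigEval (θ : ℝ) : (ℕ →₀ H) →ₗ[ℂ] H :=
  Finsupp.lsum ℂ fun j => circleChar (-(j : ℤ)) θ • LinearMap.id

/-- The shift on polynomials with coefficients in `H`. -/
noncomputable def polyShift : (ℕ →₀ H) →ₗ[ℂ] (ℕ →₀ H) := Finsupp.lmapDomain H ℂ Nat.succ

theorem trigEval_single (θ : ℝ) (j : ℕ) (h : H) :
    trigEval θ (Finsupp.single j h) = circleChar (-(j : ℤ)) θ • h := by
  simp [trigEval]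

theorem trigEval_polyShift (θ : ℝ) (x : ℕ →₀ H) :
    trigEval θ (polyShift x) = circleChar (-1) θ • trigEval θ x := by
  induction x using Finsupp.induction_linear with
  | zero => simp
  | add x y hx hy => simp [hx, hy]
  | single j h =>
    rw [polyShift, Finsupp.lmapDomain_apply, Finsupp.mapDomain_single, trigEval_single,
      trigEval_single, smul_smul, circleChar_mul]
    congr 2; push_cast; ring

@[fun_prop]
theorem continuous_trigEval (x : ℕ →₀ H) : Continuous fun θ : ℝ => trigEval θ x := by
  simp only [trigEval, Finsupp.lsum_apply, LinearMap.smul_apply, LinearMap.id_apply, Finsupp.sum]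
  fun_prop

variable (P Q₁ Q₂ : H →L[ℂ] H)

theorem trigForm_add_left (θ : ℝ) (x y z : H) :
    trigForm P Q₁ Q₂ θ (x + y) z = trigForm P Q₁ Q₂ θ x z + trigForm P Q₁ Q₂ θ y z := by
  simp only [trigForm, inner_add_left, map_add]; ring

theorem trigForm_smul_left (θ : ℝ) (c : ℂ) (x y : H) :
    trigForm P Q₁ Q₂ θ (c • x) y = (starRingEnd ℂ) c * trigForm P Q₁ Q₂ θ x y := by
  simp only [trigForm, inner_smul_left, map_smul]; ring

theorem trigForm_smul_right (θ : ℝ) (c : ℂ) (x y : H) :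
    trigForm P Q₁ Q₂ θ x (c • y) = c * trigForm P Q₁ Q₂ θ x y := by
  simp only [trigForm, inner_smul_right, map_smul]; ring

/-- The unimodular factors cancel; this makes the shift isometric for the mean form. -/
theorem trigForm_circleChar_smul (θ : ℝ) (k : ℤ) (x y : H) :
    trigForm P Q₁ Q₂ θ (circleChar k θ • x) (circleChar k θ • y) = trigForm P Q₁ Q₂ θ x y := by
  rw [trigForm_smul_left, trigForm_smul_right, conj_circleChar, ← mul_assoc, circleChar_mul]
  simp [circleChar]

theorem conj_trigForm (hP : ∀ x y, inner ℂ (P x) y = inner ℂ x (P y)) (θ : ℝ) (x y : H) :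
    (starRingEnd ℂ) (trigForm P Q₁ Q₂ θ y x) = trigForm P Q₁ Q₂ θ x y := by
  simp only [trigForm, map_add, map_mul, conj_circleChar, inner_conj_symm, hP, neg_neg]; ring

theorem re_trigForm_self (θ : ℝ) (x : H) :
    (trigForm P Q₁ Q₂ θ x x).re = (inner ℂ x (P x)).re +
      2 * (circleChar 1 θ * inner ℂ x (Q₁ x)).re +
      2 * (circleChar 1 θ ^ 2 * inner ℂ x (Q₂ x)).re := by
  have h1 : circleChar (-1) θ * inner ℂ (Q₁ x) x =
      (starRingEnd ℂ) (circleChar 1 θ * inner ℂ x (Q₁ x)) := by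
    rw [map_mul, conj_circleChar, inner_conj_symm]
  have h2 : circleChar (-2) θ * inner ℂ (Q₂ x) x =
      (starRingEnd ℂ) (circleChar 2 θ * inner ℂ x (Q₂ x)) := by
    rw [map_mul, conj_circleChar, inner_conj_symm]
  rw [trigForm, h1, h2, sq, circleChar_mul]
  simp only [Complex.add_re, Complex.conj_re, Int.reduceAdd]
  ring

@[fun_prop]
theorem continuous_trigForm (x y : ℕ →₀ H) :
    Continuous fun θ : ℝ => trigForm P Q₁ Q₂ θ (trigEval θ x) (trigEval θ y) := by
  unfold trigForm; fun_prop

/-- The mean over the circle of a trigonometric form. -/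
noncomputable def meanForm (x y : ℕ →₀ H) : ℂ :=
  (2 * Real.pi : ℂ)⁻¹ * ∫ θ in (0 : ℝ)..(2 * Real.pi),
    trigForm P Q₁ Q₂ θ (trigEval θ x) (trigEval θ y)

theorem meanForm_polyShift (x y : ℕ →₀ H) :
    meanForm P Q₁ Q₂ (polyShift x) (polyShift y) = meanForm P Q₁ Q₂ x y := by
  simp only [meanForm, trigEval_polyShift, trigForm_circleChar_smul]

theorem meanForm_add_left (x y z : ℕ →₀ H) :
    meanForm P Q₁ Q₂ (x + y) z = meanForm P Q₁ Q₂ x z + meanForm P Q₁ Q₂ y z := by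
  simp only [meanForm, map_add, trigForm_add_left]
  rw [intervalIntegral.integral_add, mul_add]
  all_goals exact (by fun_prop : Continuous _).intervalIntegrable _ _

theorem meanForm_smul_left (c : ℂ) (x y : ℕ →₀ H) :
    meanForm P Q₁ Q₂ (c • x) y = (starRingEnd ℂ) c * meanForm P Q₁ Q₂ x y := by
  simp only [meanForm, map_smul, trigForm_smul_left]
  rw [intervalIntegral.integral_const_mul]; ring

theorem conj_meanForm (hP : ∀ x y, inner ℂ (P x) y = inner ℂ x (P y)) (x y : ℕ →₀ H) :
    (starRingEnd ℂ) (meanForm P Q₁ Q₂ y x) = meanForm P Q₁ Q₂ x y := by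
  simp only [meanForm, map_mul, ← intervalIntegral.intervalIntegral_conj, conj_trigForm P Q₁ Q₂ hP,
    map_inv₀, Complex.conj_ofReal, map_ofNat]

theorem re_meanForm_self_nonneg (hpos : ∀ (z : ℂ) (h : H), ‖z‖ = 1 →
    0 ≤ (inner ℂ h (P h)).re + 2 * (z * inner ℂ h (Q₁ h)).re + 2 * (z ^ 2 * inner ℂ h (Q₂ h)).re)
    (x : ℕ →₀ H) : 0 ≤ (meanForm P Q₁ Q₂ x x).re := by
  have h : (meanForm P Q₁ Q₂ x x).re = (2 * Real.pi)⁻¹ * ∫ θ in (0 : ℝ)..(2 * Real.pi),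
      (trigForm P Q₁ Q₂ θ (trigEval θ x) (trigEval θ x)).re := by
    have := intervalIntegral.intervalIntegral_re (𝕜 := ℂ) (μ := MeasureTheory.volume)
      (((by fun_prop : Continuous fun θ : ℝ =>
        trigForm P Q₁ Q₂ θ (trigEval θ x) (trigEval θ x))).intervalIntegrable 0 (2 * Real.pi))
    simp only [RCLike.re_eq_complex_re] at this
    rw [this, meanForm]
    have e : (2 * Real.pi : ℂ)⁻¹ = (((2 * Real.pi)⁻¹ : ℝ) : ℂ) := by push_cast; rfl
    rw [e, Complex.re_ofReal_mul]
  rw [h]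
  refine mul_nonneg (by positivity) (intervalIntegral.integral_nonneg (by positivity) ?_)
  intro θ _
  rw [re_trigForm_self]
  exact hpos _ _ (norm_circleChar _ _)

/-- Evaluation at `exp (-iθ)` makes the `n`-th power contribute `exp (-inθ)`, so the mean extracts
the coefficient of `exp (inθ)`. It vanishes for `n ≥ 3`, which is the orthogonality needed for the
factorization. -/
theorem meanForm_single (h g : H) (n : ℕ) :
    meanForm P Q₁ Q₂ (Finsupp.single 0 h) (Finsupp.single n g) =
      (if n = 0 then inner ℂ h (P g) else 0) + (if n = 1 then inner ℂ h (Q₁ g) else 0) +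
        (if n = 2 then inner ℂ h (Q₂ g) else 0) := by
  have e : ∀ θ : ℝ, trigForm P Q₁ Q₂ θ (trigEval θ (Finsupp.single 0 h))
      (trigEval θ (Finsupp.single n g)) = inner ℂ h (P g) * circleChar (-n) θ +
        inner ℂ h (Q₁ g) * circleChar (1 - n) θ + inner ℂ (Q₁ h) g * circleChar (-1 - n) θ +
        inner ℂ h (Q₂ g) * circleChar (2 - n) θ + inner ℂ (Q₂ h) g * circleChar (-2 - n) θ := by
    intro θ
    have h0 : trigEval θ (Finsupp.single 0 h) = h := by
      rw [trigEval_single]; simp [circleChar]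
    rw [h0, trigEval_single, trigForm_smul_right, trigForm]
    simp only [sub_eq_add_neg, ← circleChar_mul]
    ring
  simp only [meanForm, e]
  repeat rw [intervalIntegral.integral_add (by apply Continuous.intervalIntegrable; fun_prop)
    (by apply Continuous.intervalIntegrable; fun_prop)]
  simp only [intervalIntegral.integral_const_mul, integral_circleChar]
  have hpi : (2 * Real.pi : ℂ) ≠ 0 := by simp [Real.pi_ne_zero]
  have c1 : (-(n : ℤ) = 0) ↔ n = 0 := by omega
  have c2 : (1 - (n : ℤ) = 0) ↔ n = 1 := by omega
  have c3 : (2 - (n : ℤ) = 0) ↔ n = 2 := by omega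
  have c4 : ¬ (-1 - (n : ℤ) = 0) := by omega
  have c5 : ¬ (-2 - (n : ℤ) = 0) := by omega
  simp only [c1, c2, c3, c4, c5, if_false, mul_zero, add_zero]
  split_ifs <;> field_simp <;> simp [mul_add]

end TrigonometricForm

/-! ### The operator Fejér-Riesz theorem in degree two. -/

section TrigonometricForm

universe u

/-- The operator Fejér-Riesz theorem in degree two. -/
theorem exists_fejer_riesz {H : Type u} [NormedAddCommGroup H] [InnerProductSpace ℂ H]
    (P Q₁ Q₂ : H →L[ℂ] H) (hP : ∀ x y, inner ℂ (P x) y = inner ℂ x (P y))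
    (hpos : ∀ (z : ℂ) (h : H), ‖z‖ = 1 →
      0 ≤ (inner ℂ h (P h)).re + 2 * (z * inner ℂ h (Q₁ h)).re +
        2 * (z ^ 2 * inner ℂ h (Q₂ h)).re) :
    ∃ (K : Type u) (_ : NormedAddCommGroup K) (_ : InnerProductSpace ℂ K) (_ : CompleteSpace K)
      (X₀ X₁ X₂ : H →L[ℂ] K), ∀ (z : ℂ) (h : H), ‖z‖ = 1 →
      ‖X₀ h + z • X₁ h + z ^ 2 • X₂ h‖ ^ 2 = (inner ℂ h (P h)).re +
        2 * (z * inner ℂ h (Q₁ h)).re + 2 * (z ^ 2 * inner ℂ h (Q₂ h)).re := by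
  -- The form may be degenerate, so this is only a semi-inner product; the completion removes its
  -- null vectors.
  let core : PreInnerProductSpace.Core ℂ (ℕ →₀ H) :=
    { inner := meanForm P Q₁ Q₂
      conj_inner_symm := conj_meanForm P Q₁ Q₂ hP
      re_inner_nonneg := re_meanForm_self_nonneg P Q₁ Q₂ hpos
      add_left := meanForm_add_left P Q₁ Q₂
      smul_left := fun x y c => meanForm_smul_left P Q₁ Q₂ c x y }
  let : SeminormedAddCommGroup (ℕ →₀ H) :=
    InnerProductSpace.Core.toSeminormedAddCommGroup (𝕜 := ℂ)
  let : InnerProductSpace ℂ (ℕ →₀ H) := InnerProductSpace.ofCore core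
  have hinner : ∀ x y : ℕ →₀ H, inner ℂ x y = meanForm P Q₁ Q₂ x y := fun _ _ => rfl
  have hnorm : ∀ x : ℕ →₀ H, ‖x‖ ^ 2 = (meanForm P Q₁ Q₂ x x).re := fun x => by
    rw [← hinner]; exact norm_sq_eq_re_inner (𝕜 := ℂ) x
  let U : (ℕ →₀ H) →ₗᵢ[ℂ] (ℕ →₀ H) :=
    { polyShift with
      norm_map' := fun x => by
        have : ‖polyShift x‖ ^ 2 = ‖x‖ ^ 2 := by rw [hnorm, hnorm, meanForm_polyShift]
        exact (pow_left_inj₀ (norm_nonneg _) (norm_nonneg _) two_ne_zero).1 this }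
  have hU : ∀ x, U x = polyShift x := fun _ => rfl
  have hshift : ∀ (n : ℕ) (h : H), polyShift (Finsupp.single n h) = Finsupp.single (n + 1) h := by
    intro n h
    rw [polyShift, Finsupp.lmapDomain_apply, Finsupp.mapDomain_single]
  have hδ0 : ∀ h : H, ‖(Finsupp.single 0 h : ℕ →₀ H)‖ ^ 2 = (inner ℂ h (P h)).re := fun h => by
    rw [hnorm, meanForm_single]; simp
  -- Constant polynomials. The bound is `‖δ h‖² = ⟨P h, h⟩ ≤ ‖P‖ ‖h‖²`.
  let δ : H →L[ℂ] (ℕ →₀ H) := (Finsupp.lsingle (R := ℂ) 0 : H →ₗ[ℂ] (ℕ →₀ H)).mkContinuous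
    (Real.sqrt ‖P‖) fun h => by
      rw [Finsupp.lsingle_apply]
      refine abs_le_of_sq_le_sq' ?_ (by positivity) |>.2
      rw [hδ0, mul_pow, Real.sq_sqrt (norm_nonneg _)]
      calc (inner ℂ h (P h)).re ≤ ‖inner ℂ h (P h)‖ := Complex.re_le_norm _
        _ ≤ ‖h‖ * ‖P h‖ := norm_inner_le_norm _ _
        _ ≤ ‖h‖ * (‖P‖ * ‖h‖) := by gcongr; exact P.le_opNorm h
        _ = ‖P‖ * ‖h‖ ^ 2 := by ring
  have hδ : ∀ h, δ h = Finsupp.single 0 h := fun _ => rfl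
  have horth : ∀ h x, inner ℂ (δ h) (U (U (U x))) = 0 := by
    intro h x
    induction x using Finsupp.induction_linear with
    | zero => simp
    | add x y hx hy => simp only [map_add, inner_add_right, hx, hy, add_zero]
    | single j g =>
      simp only [hU, hshift, hδ, hinner, meanForm_single]
      simp
  obtain ⟨X₀, X₁, X₂, hX⟩ := exists_factorization_of_isometry U δ horth
  refine ⟨UniformSpace.Completion (ℕ →₀ H), inferInstance, inferInstance, inferInstance,
    X₀, X₁, X₂, fun z h hz => ?_⟩
  rw [hX z h hz, inner_smul_right, inner_smul_right]
  simp only [hδ, hU, hshift, hδ0, hinner, meanForm_single]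
  simp

end TrigonometricForm

/-! ### Factorization of positive quadratic operator pencils. -/

section QuadraticFamily

universe u

variable {H : Type u} [NormedAddCommGroup H] [InnerProductSpace ℂ H]

/-- The operators `c, b, a` satisfy
`s² c + s t b + t² a = (s Z₀ + t Z₁)* (s Z₀ + t Z₁) + (l₀ s² + l₁ s t + l₂ t²) Y* Y`
for all real `s` and `t`. -/
def HasQuadraticFactorization (c b a : H →L[ℂ] H) (l₀ l₁ l₂ : ℝ) : Prop :=
  ∃ (K : Type u) (_ : NormedAddCommGroup K) (_ : InnerProductSpace ℂ K) (_ : CompleteSpace K)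
    (Z₀ Z₁ Y : H →L[ℂ] K), ∀ h : H,
      c.reApplyInnerSelf h = ‖Z₀ h‖ ^ 2 + l₀ * ‖Y h‖ ^ 2 ∧
      b.reApplyInnerSelf h = 2 * (inner ℂ (Z₀ h) (Z₁ h)).re + l₁ * ‖Y h‖ ^ 2 ∧
      a.reApplyInnerSelf h = ‖Z₁ h‖ ^ 2 + l₂ * ‖Y h‖ ^ 2

theorem inner_apply_self_of_isSymmetric {T : H →L[ℂ] H}
    (hT : ∀ x y, inner ℂ (T x) y = inner ℂ x (T y)) (h : H) :
    inner ℂ h (T h) = (T.reApplyInnerSelf h : ℂ) := by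
  rw [ContinuousLinearMap.reApplyInnerSelf_apply, ← hT]
  refine (Complex.conj_eq_iff_re.1 ?_).symm
  rw [inner_conj_symm, hT]

theorem reApplyInnerSelf_add (S T : H →L[ℂ] H) (h : H) :
    (S + T).reApplyInnerSelf h = S.reApplyInnerSelf h + T.reApplyInnerSelf h := by
  simp [ContinuousLinearMap.reApplyInnerSelf_apply, inner_add_left]

theorem reApplyInnerSelf_ofReal_smul (r : ℝ) (T : H →L[ℂ] H) (h : H) :
    ((r : ℂ) • T).reApplyInnerSelf h = r * T.reApplyInnerSelf h := by
  rw [ContinuousLinearMap.reApplyInnerSelf_apply, ContinuousLinearMap.reApplyInnerSelf_apply,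
    smul_apply, inner_smul_left, Complex.conj_ofReal]
  exact Complex.re_ofReal_mul _ _

theorem isSymmetric_add {S T : H →L[ℂ] H} (hS : ∀ x y, inner ℂ (S x) y = inner ℂ x (S y))
    (hT : ∀ x y, inner ℂ (T x) y = inner ℂ x (T y)) (x y : H) :
    inner ℂ ((S + T) x) y = inner ℂ x ((S + T) y) := by
  rw [add_apply, add_apply, inner_add_left, inner_add_right, hS, hT]

theorem isSymmetric_ofReal_smul (r : ℝ) {T : H →L[ℂ] H}
    (hT : ∀ x y, inner ℂ (T x) y = inner ℂ x (T y)) (x y : H) :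
    inner ℂ (((r : ℂ) • T) x) y = inner ℂ x (((r : ℂ) • T) y) := by
  rw [smul_apply, smul_apply, inner_smul_left, inner_smul_right, hT, Complex.conj_ofReal]

/-- A quadratic operator polynomial that is positive on `[-1, 1]` is a sum of a square and of a
positive multiple of `1 - t²`. -/
theorem hasQuadraticFactorization_of_nonneg_interval (c b a : H →L[ℂ] H)
    (hc : ∀ x y, inner ℂ (c x) y = inner ℂ x (c y)) (hb : ∀ x y, inner ℂ (b x) y = inner ℂ x (b y))
    (ha : ∀ x y, inner ℂ (a x) y = inner ℂ x (a y))
    (hpos : ∀ t : ℝ, t ^ 2 ≤ 1 → ∀ h, 0 ≤ c.reApplyInnerSelf h + t * b.reApplyInnerSelf h +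
      t ^ 2 * a.reApplyInnerSelf h) :
    HasQuadraticFactorization c b a 1 0 (-1) := by
  -- Substitute `t = Re z = (z + z⁻¹) / 2`, so that `t² = (z² + 2 + z⁻²) / 4`; this explains the
  -- coefficients `c + a / 2`, `b / 2`, `a / 4`.
  have key : ∀ (z : ℂ) (h : H), ‖z‖ = 1 →
      (inner ℂ h ((c + ((2⁻¹ : ℝ) : ℂ) • a) h)).re +
        2 * (z * inner ℂ h ((((2⁻¹ : ℝ) : ℂ) • b) h)).re +
        2 * (z ^ 2 * inner ℂ h ((((4⁻¹ : ℝ) : ℂ) • a) h)).re =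
      c.reApplyInnerSelf h + z.re * b.reApplyInnerSelf h + z.re ^ 2 * a.reApplyInnerSelf h := by
    intro z h hz
    have hz2 : z.re ^ 2 + z.im ^ 2 = 1 := by
      have := Complex.normSq_eq_norm_sq z
      rw [Complex.normSq_apply, hz] at this; linarith
    rw [inner_apply_self_of_isSymmetric (isSymmetric_add hc (isSymmetric_ofReal_smul _ ha)),
      inner_apply_self_of_isSymmetric (isSymmetric_ofReal_smul _ hb),
      inner_apply_self_of_isSymmetric (isSymmetric_ofReal_smul _ ha)]
    rw [Complex.re_mul_ofReal, Complex.re_mul_ofReal, Complex.ofReal_re, reApplyInnerSelf_add,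
      reApplyInnerSelf_ofReal_smul, reApplyInnerSelf_ofReal_smul, reApplyInnerSelf_ofReal_smul,
      sq z, Complex.mul_re]
    have : z.im * z.im = 1 - z.re ^ 2 := by linarith
    rw [this]; ring
  obtain ⟨K, i1, i2, i3, X₀, X₁, X₂, hX⟩ := exists_fejer_riesz
    (c + ((2⁻¹ : ℝ) : ℂ) • a) (((2⁻¹ : ℝ) : ℂ) • b) (((4⁻¹ : ℝ) : ℂ) • a)
    (isSymmetric_add hc (isSymmetric_ofReal_smul _ ha)) (fun z h hz => by
      rw [key z h hz]
      refine hpos _ ?_ h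
      have := Complex.abs_re_le_norm z
      rw [hz] at this
      exact (sq_le_one_iff_abs_le_one _).2 this)
  -- For `z = exp (iθ)`, the factor divided by `z` is `X₁ + cos θ (X₀ + X₂) - i sin θ (X₀ - X₂)`.
  -- The sine part supplies `1 - t²`, and the values at `±1`, `±i` determine all three coefficients.
  refine ⟨K, i1, i2, i3, X₁, X₀ + X₂, X₀ - X₂, fun h => ?_⟩
  have e1 := hX 1 h (by simp)
  have e2 := hX (-1) h (by simp)
  have e3 := hX Complex.I h (by simp)
  have e4 := hX (-Complex.I) h (by simp)
  rw [key _ _ (by simp)] at e1 e2 e3 e4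
  have r1 : X₀ h + (1 : ℂ) • X₁ h + (1 : ℂ) ^ 2 • X₂ h = (X₀ + X₂) h + X₁ h := by
    simp; abel
  have r2 : X₀ h + (-1 : ℂ) • X₁ h + (-1 : ℂ) ^ 2 • X₂ h = (X₀ + X₂) h - X₁ h := by
    simp; abel
  have r3 : X₀ h + Complex.I • X₁ h + Complex.I ^ 2 • X₂ h =
      (X₀ - X₂) h + Complex.I • X₁ h := by
    simp; abel
  have r4 : X₀ h + (-Complex.I) • X₁ h + (-Complex.I) ^ 2 • X₂ h =
      (X₀ - X₂) h - Complex.I • X₁ h := by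
    simp; abel
  rw [r1, @norm_add_sq ℂ] at e1
  rw [r2, @norm_sub_sq ℂ] at e2
  rw [r3, @norm_add_sq ℂ, norm_smul, Complex.norm_I, one_mul] at e3
  rw [r4, @norm_sub_sq ℂ, norm_smul, Complex.norm_I, one_mul] at e4
  have e5 : (inner ℂ (X₁ h) ((X₀ + X₂) h)).re = (inner ℂ ((X₀ + X₂) h) (X₁ h)).re :=
    inner_re_symm (𝕜 := ℂ) _ _
  simp only [Complex.one_re, Complex.neg_re, Complex.I_re, RCLike.re_eq_complex_re] at e1 e2 e3 e4
  refine ⟨by linarith, ?_, by linarith⟩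
  rw [e5]; linarith

/-- A family of bounded operators into `K` is a bounded operator into a Hilbert sum. -/
theorem exists_hilbert_sum_operator {n : ℕ} {K : Type*} [NormedAddCommGroup K]
    [InnerProductSpace ℂ K] (f : Fin n → H →L[ℂ] K) :
    ∃ T : H →L[ℂ] PiLp 2 (fun _ : Fin n => K), ∀ h i, T h i = f i h :=
  ⟨((PiLp.continuousLinearEquiv 2 ℂ (fun _ : Fin n => K)).symm :
      (Fin n → K) →L[ℂ] PiLp 2 (fun _ : Fin n => K)) ∘L ContinuousLinearMap.pi f, fun _ _ => rfl⟩

/-- A quadratic operator polynomial that is positive on the real line is a square. -/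
theorem hasQuadraticFactorization_of_nonneg (c b a : H →L[ℂ] H)
    (hc : ∀ x y, inner ℂ (c x) y = inner ℂ x (c y)) (hb : ∀ x y, inner ℂ (b x) y = inner ℂ x (b y))
    (ha : ∀ x y, inner ℂ (a x) y = inner ℂ x (a y)) (l₀ l₁ l₂ : ℝ)
    (hpos : ∀ (s t : ℝ) (h : H), 0 ≤ s ^ 2 * c.reApplyInnerSelf h +
      s * t * b.reApplyInnerSelf h + t ^ 2 * a.reApplyInnerSelf h) :
    HasQuadraticFactorization c b a l₀ l₁ l₂ := by
  -- Here `z = s + i t` on the unit circle: `s² - t² = Re z²` and `2 s t = Im z²`, so only even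
  -- powers of `z` occur.
  have key : ∀ (z : ℂ) (h : H), ‖z‖ = 1 →
      (inner ℂ h ((((2⁻¹ : ℝ) : ℂ) • (c + a)) h)).re +
        2 * (z * inner ℂ h ((0 : H →L[ℂ] H) h)).re +
        2 * (z ^ 2 * inner ℂ h ((((4⁻¹ : ℝ) : ℂ) • (c + ((-1 : ℝ) : ℂ) • a) -
          Complex.I • ((4⁻¹ : ℝ) : ℂ) • b) h)).re =
      z.re ^ 2 * c.reApplyInnerSelf h + z.re * z.im * b.reApplyInnerSelf h +
        z.im ^ 2 * a.reApplyInnerSelf h := by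
    intro z h hz
    have hz2 : z.re ^ 2 = 1 - z.im ^ 2 := by
      have := Complex.normSq_eq_norm_sq z
      rw [Complex.normSq_apply, hz] at this; linarith
    rw [inner_apply_self_of_isSymmetric (isSymmetric_ofReal_smul _ (isSymmetric_add hc ha)),
      sub_apply, inner_sub_right, show (Complex.I • ((4⁻¹ : ℝ) : ℂ) • b) h =
        Complex.I • (((4⁻¹ : ℝ) : ℂ) • b) h from rfl, inner_smul_right,
      inner_apply_self_of_isSymmetric (isSymmetric_ofReal_smul _
        (isSymmetric_add hc (isSymmetric_ofReal_smul _ ha))),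
      inner_apply_self_of_isSymmetric (isSymmetric_ofReal_smul _ hb)]
    simp only [reApplyInnerSelf_add, reApplyInnerSelf_ofReal_smul, Complex.ofReal_re,
      zero_apply, inner_zero_right, mul_zero, Complex.zero_re, sq z]
    simp only [Complex.mul_re, Complex.mul_im, Complex.sub_re, Complex.sub_im, Complex.I_re,
      Complex.I_im, Complex.ofReal_re, Complex.ofReal_im]
    linear_combination (-(c.reApplyInnerSelf h + a.reApplyInnerSelf h) / 2) * hz2
  obtain ⟨K, i1, i2, i3, X₀, X₁, X₂, hX⟩ := exists_fejer_riesz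
    (((2⁻¹ : ℝ) : ℂ) • (c + a)) 0
    (((4⁻¹ : ℝ) : ℂ) • (c + ((-1 : ℝ) : ℂ) • a) - Complex.I • ((4⁻¹ : ℝ) : ℂ) • b)
    (isSymmetric_ofReal_smul _ (isSymmetric_add hc ha)) (fun z h hz => by
      rw [key z h hz]; exact hpos _ _ h)
  -- The factor divided by `z` is `X₁ + s (X₀ + X₂) - i t (X₀ - X₂)`. Averaging over `z` and `-z`
  -- removes the cross terms with `X₁`, and `‖X₁ h‖² = (s² + t²) ‖X₁ h‖²` is made homogeneous by the
  -- two extra coordinates. Since `Y = 0`, the numbers `l₀, l₁, l₂` are arbitrary.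
  obtain ⟨Z₀, hZ₀⟩ := exists_hilbert_sum_operator ![X₀ + X₂, X₁, 0]
  obtain ⟨Z₁, hZ₁⟩ := exists_hilbert_sum_operator ![(-Complex.I) • (X₀ - X₂), 0, X₁]
  refine ⟨PiLp 2 (fun _ : Fin 3 => K), inferInstance, inferInstance, inferInstance, Z₀, Z₁, 0,
    fun h => ?_⟩
  -- The point `exp (iπ/4)`, where `s t = 1/2`, detects the mixed coefficient `b`.
  let ζ : ℂ := ⟨(Real.sqrt 2)⁻¹, (Real.sqrt 2)⁻¹⟩
  have hr : ((Real.sqrt 2)⁻¹) ^ 2 = 2⁻¹ := by rw [inv_pow, Real.sq_sqrt (by norm_num)]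
  have hζre : ζ.re = (Real.sqrt 2)⁻¹ := rfl
  have hζim : ζ.im = (Real.sqrt 2)⁻¹ := rfl
  have hζ2 : ζ ^ 2 = Complex.I := by
    apply Complex.ext
    · rw [sq, Complex.mul_re, hζre, hζim]; simp
    · rw [sq, Complex.mul_im, hζre, hζim, ← sq, hr, Complex.I_im]; norm_num
  have hζ : ‖ζ‖ = 1 := by
    have : ‖ζ‖ ^ 2 = 1 := by rw [← norm_pow, hζ2, Complex.norm_I]
    exact (pow_eq_one_iff_of_nonneg (norm_nonneg _) two_ne_zero).1 this
  have e1 := hX 1 h (by simp)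
  have e2 := hX (-1) h (by simp)
  have e3 := hX Complex.I h (by simp)
  have e4 := hX (-Complex.I) h (by simp)
  have e5 := hX ζ h hζ
  have e6 := hX (-ζ) h (by rw [norm_neg, hζ])
  rw [key _ _ (by simp)] at e1 e2 e3 e4
  rw [key _ _ hζ] at e5
  rw [key _ _ (by rw [norm_neg, hζ])] at e6
  have r1 : ∀ z : ℂ, X₀ h + z • X₁ h + z ^ 2 • X₂ h = (X₀ h + z ^ 2 • X₂ h) + z • X₁ h := by
    intro z; abel
  have n0 : ∀ z : ℂ, ‖z‖ = 1 → ‖(X₀ h + z ^ 2 • X₂ h) + z • X₁ h‖ ^ 2 +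
      ‖(X₀ h + z ^ 2 • X₂ h) + (-z) • X₁ h‖ ^ 2 =
      2 * (‖X₀ h‖ ^ 2 + ‖X₂ h‖ ^ 2 + 2 * (z ^ 2 * inner ℂ (X₀ h) (X₂ h)).re) +
        2 * ‖X₁ h‖ ^ 2 := by
    intro z hz
    rw [neg_smul, ← sub_eq_add_neg, @norm_add_sq ℂ, @norm_sub_sq ℂ, @norm_add_sq ℂ, norm_smul,
      norm_smul, norm_pow, hz, inner_smul_right (X₀ h)]
    simp only [RCLike.re_eq_complex_re]; ring
  have m1 := n0 1 (by simp)
  have m2 := n0 Complex.I (by simp)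
  have m3 := n0 ζ hζ
  rw [r1] at e1 e2 e3 e4 e5 e6
  rw [neg_sq] at e2 e4 e6
  rw [e1, e2] at m1
  rw [e3, e4] at m2
  rw [e5, e6, hζ2] at m3
  simp only [Complex.neg_re, Complex.neg_im, hζre, hζim, neg_sq, hr, neg_mul_neg, ← sq,
    Complex.one_re, Complex.one_im, Complex.I_re, Complex.I_im, Complex.I_sq, Complex.mul_re,
    Complex.neg_re, Complex.neg_im, one_pow] at m1 m2 m3
  have s1 : (inner ℂ (X₂ h) (X₀ h)).re = (inner ℂ (X₀ h) (X₂ h)).re :=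
    inner_re_symm (𝕜 := ℂ) _ _
  have s2 : (inner ℂ (X₂ h) (X₀ h)).im = -(inner ℂ (X₀ h) (X₂ h)).im :=
    inner_im_symm (𝕜 := ℂ) _ _
  have s3 : (inner ℂ (X₀ h) (X₀ h)).im = 0 := inner_self_im (𝕜 := ℂ) _
  have s4 : (inner ℂ (X₂ h) (X₂ h)).im = 0 := inner_self_im (𝕜 := ℂ) _
  refine ⟨?_, ?_, ?_⟩
  · rw [PiLp.norm_sq_eq_of_L2]
    simp only [hZ₀, Fin.sum_univ_three, Matrix.cons_val_zero, Matrix.cons_val_one,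
      Matrix.cons_val, add_apply, zero_apply, norm_zero]
    rw [@norm_add_sq ℂ]
    simp only [RCLike.re_eq_complex_re]
    linarith
  · rw [PiLp.inner_apply]
    simp only [hZ₀, hZ₁, Fin.sum_univ_three, Matrix.cons_val_zero, Matrix.cons_val_one,
      Matrix.cons_val, add_apply, zero_apply, norm_zero, inner_zero_left, inner_zero_right,
      smul_apply, sub_apply, inner_smul_right, inner_add_left,
      inner_sub_right, add_zero, Complex.mul_re, Complex.neg_re, Complex.neg_im, Complex.I_re,
      Complex.I_im, Complex.add_im, Complex.sub_im, s2, s3, s4]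
    linarith
  · rw [PiLp.norm_sq_eq_of_L2]
    simp only [hZ₁, Fin.sum_univ_three, Matrix.cons_val_zero, Matrix.cons_val_one,
      Matrix.cons_val, sub_apply, zero_apply, norm_zero, smul_apply,
      norm_smul, norm_neg, Complex.norm_I, one_mul]
    rw [@norm_sub_sq ℂ]
    simp only [RCLike.re_eq_complex_re]
    linarith

end QuadraticFamily

/-! ### The operator S-lemma in two real variables. -/

section QuadraticFamily

universe u

variable {H : Type u} [NormedAddCommGroup H] [InnerProductSpace ℂ H]

theorem HasQuadraticFactorization.swap {c b a : H →L[ℂ] H} {l₀ l₁ l₂ : ℝ}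
    (h : HasQuadraticFactorization c b a l₀ l₁ l₂) :
    HasQuadraticFactorization a b c l₂ l₁ l₀ := by
  obtain ⟨K, i1, i2, i3, Z₀, Z₁, Y, hZ⟩ := h
  refine ⟨K, i1, i2, i3, Z₁, Z₀, Y, fun h => ⟨(hZ h).2.2, ?_, (hZ h).1⟩⟩
  rw [(hZ h).2.1]
  congr 2
  exact inner_re_symm (𝕜 := ℂ) _ _

/-- The `S`-lemma for an operator-valued quadratic form in two real variables and an indefinite
scalar quadratic form with positive leading coefficient. -/
theorem hasQuadraticFactorization_of_indefinite (c b a : H →L[ℂ] H)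
    (hc : ∀ x y, inner ℂ (c x) y = inner ℂ x (c y)) (hb : ∀ x y, inner ℂ (b x) y = inner ℂ x (b y))
    (ha : ∀ x y, inner ℂ (a x) y = inner ℂ x (a y)) (p m q : ℝ) (hp : 0 < p)
    (hD : 0 < m ^ 2 - p * q)
    (hpos : ∀ s t : ℝ, 0 ≤ p * s ^ 2 + 2 * m * (s * t) + q * t ^ 2 → ∀ h : H,
      0 ≤ s ^ 2 * c.reApplyInnerSelf h + s * t * b.reApplyInnerSelf h +
        t ^ 2 * a.reApplyInnerSelf h) :
    HasQuadraticFactorization c b a p (2 * m) q := by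
  obtain ⟨σ, hσ, hσ2⟩ : ∃ σ : ℝ, 0 < σ ∧ σ ^ 2 = m ^ 2 - p * q :=
    ⟨_, Real.sqrt_pos.2 hD, Real.sq_sqrt hD.le⟩
  obtain ⟨K, i1, i2, i3, Z₀, Z₁, Y, hZ⟩ := hasQuadraticFactorization_of_nonneg_interval
    (((σ ^ 2 : ℝ) : ℂ) • c) (((σ * p : ℝ) : ℂ) • b + ((-(2 * σ * m) : ℝ) : ℂ) • c)
    (((m ^ 2 : ℝ) : ℂ) • c + ((-(m * p) : ℝ) : ℂ) • b + ((p ^ 2 : ℝ) : ℂ) • a)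
    (isSymmetric_ofReal_smul _ hc)
    (isSymmetric_add (isSymmetric_ofReal_smul _ hb) (isSymmetric_ofReal_smul _ hc))
    (isSymmetric_add (isSymmetric_add (isSymmetric_ofReal_smul _ hc)
      (isSymmetric_ofReal_smul _ hb)) (isSymmetric_ofReal_smul _ ha)) (by
    intro t ht h
    simp only [reApplyInnerSelf_add, reApplyInnerSelf_ofReal_smul]
    -- Completing the square: along `(σ - m t, p t)` the scalar form becomes `p σ² (1 - t²)`, and
    -- the pencil becomes the one passed to `hasQuadraticFactorization_of_nonneg_interval`.
    have := hpos (σ - m * t) (p * t) (by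
      have e : p * (σ - m * t) ^ 2 + 2 * m * ((σ - m * t) * (p * t)) + q * (p * t) ^ 2 =
          p * σ ^ 2 * (1 - t ^ 2) := by
        linear_combination (p * t ^ 2) * hσ2
      rw [e]
      have : 0 ≤ 1 - t ^ 2 := by linarith
      positivity) h
    linarith)
  obtain ⟨r, hr⟩ : ∃ r : ℝ, r ^ 2 * p = 1 := by
    refine ⟨(Real.sqrt p)⁻¹, ?_⟩
    rw [inv_pow, Real.sq_sqrt hp.le, inv_mul_cancel₀ hp.ne']
  -- The inverse change of variables; `Y` is divided by `σ √p`, since the scalar form is `p σ²`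
  -- times the transformed one.
  refine ⟨K, i1, i2, i3, ((σ⁻¹ : ℝ) : ℂ) • Z₀,
    ((m / (p * σ) : ℝ) : ℂ) • Z₀ + ((p⁻¹ : ℝ) : ℂ) • Z₁, ((r / σ : ℝ) : ℂ) • Y, fun h => ?_⟩
  obtain ⟨h0, h1, h2⟩ := hZ h
  simp only [reApplyInnerSelf_add, reApplyInnerSelf_ofReal_smul] at h0 h1 h2
  set α := a.reApplyInnerSelf h
  set β := b.reApplyInnerSelf h
  set γ := c.reApplyInnerSelf h
  have hY : ‖(((r / σ : ℝ) : ℂ) • Y) h‖ ^ 2 = r ^ 2 / σ ^ 2 * ‖Y h‖ ^ 2 := by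
    rw [smul_apply, norm_smul, mul_pow, Complex.norm_real, Real.norm_eq_abs, sq_abs, div_pow]
  have hr' : r ^ 2 = p⁻¹ := eq_inv_of_mul_eq_one_left hr
  have hZ₀ : ‖(((σ⁻¹ : ℝ) : ℂ) • Z₀) h‖ ^ 2 = ‖Z₀ h‖ ^ 2 / σ ^ 2 := by
    rw [smul_apply, norm_smul, mul_pow, Complex.norm_real, Real.norm_eq_abs, sq_abs, inv_pow]
    ring
  have hγ : γ = (‖Z₀ h‖ ^ 2 + ‖Y h‖ ^ 2) / σ ^ 2 := by
    field_simp; linarith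
  have hβ : β = (2 * (inner ℂ (Z₀ h) (Z₁ h)).re + 2 * σ * m * γ) / (σ * p) := by
    field_simp; linarith
  have hα : α = (‖Z₁ h‖ ^ 2 - ‖Y h‖ ^ 2 - m ^ 2 * γ + m * p * β) / p ^ 2 := by
    field_simp; linarith
  have hq : q = (m ^ 2 - σ ^ 2) / p := by field_simp; linarith
  rw [hY, hZ₀, hr']
  refine ⟨?_, ?_, ?_⟩
  · rw [hγ]; field_simp
  · rw [hβ, hγ]
    simp only [add_apply, smul_apply, inner_add_right, inner_smul_left, inner_smul_right,
      Complex.conj_ofReal, Complex.add_re, Complex.re_ofReal_mul]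
    rw [show (inner ℂ (Z₀ h) (Z₀ h)).re = ‖Z₀ h‖ ^ 2 from inner_self_eq_norm_sq (𝕜 := ℂ) _]
    field_simp
    ring
  · rw [hα, hβ, hγ, hq, add_apply, smul_apply, smul_apply, @norm_add_sq ℂ, norm_smul, norm_smul,
      mul_pow, mul_pow, Complex.norm_real, Complex.norm_real, Real.norm_eq_abs, Real.norm_eq_abs,
      sq_abs, sq_abs]
    simp only [inner_smul_left, inner_smul_right, Complex.conj_ofReal, RCLike.re_eq_complex_re,
      Complex.re_ofReal_mul]
    field_simp
    ring

/-- The `S`-lemma for an operator-valued quadratic form in two real variables and a scalar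
quadratic form of trace one. -/
theorem hasQuadraticFactorization_of_trace_eq_one (c b a : H →L[ℂ] H)
    (hc : ∀ x y, inner ℂ (c x) y = inner ℂ x (c y)) (hb : ∀ x y, inner ℂ (b x) y = inner ℂ x (b y))
    (ha : ∀ x y, inner ℂ (a x) y = inner ℂ x (a y)) (p m q : ℝ) (hpq : p + q = 1)
    (hpos : ∀ s t : ℝ, 0 ≤ p * s ^ 2 + 2 * m * (s * t) + q * t ^ 2 → ∀ h : H,
      0 ≤ s ^ 2 * c.reApplyInnerSelf h + s * t * b.reApplyInnerSelf h +
        t ^ 2 * a.reApplyInnerSelf h) :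
    HasQuadraticFactorization c b a p (2 * m) q := by
  -- With nonpositive discriminant, trace one makes the scalar form nonnegative everywhere, so the
  -- pencil is positive without restriction. Otherwise trace one makes `p` or `q` positive.
  rcases le_or_gt (m ^ 2 - p * q) 0 with hD | hD
  · refine hasQuadraticFactorization_of_nonneg c b a hc hb ha _ _ _ fun s t h => hpos s t ?_ h
    have hp : 0 ≤ p := by nlinarith [sq_nonneg m, sq_nonneg p]
    have hq : 0 ≤ q := by nlinarith [sq_nonneg m, sq_nonneg q]
    rcases hp.eq_or_lt with rfl | hp'
    · have : m = 0 := by nlinarith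
      subst this
      nlinarith [sq_nonneg t]
    · have : 0 ≤ p * (p * s ^ 2 + 2 * m * (s * t) + q * t ^ 2) := by
        nlinarith [sq_nonneg (p * s + m * t), sq_nonneg t]
      exact nonneg_of_mul_nonneg_right this hp'
  · rcases lt_or_ge 0 p with hp | hp
    · exact hasQuadraticFactorization_of_indefinite c b a hc hb ha p m q hp hD hpos
    · refine (hasQuadraticFactorization_of_indefinite a b c ha hb hc q m p (by linarith)
        (by linarith) fun s t hst h => ?_).swap
      have := hpos t s (by linarith) h
      linarith

end QuadraticFamily

/-! ### Domination, dilations in coordinates, and dual bases. -/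

section Compression

universe u

open Matrix

variable {H : Type u} [NormedAddCommGroup H] [InnerProductSpace ℂ H]
variable {n : Type} [Fintype n] [DecidableEq n]

/-- Every real affine function of `W(A)` that is nonnegative is nonnegative on `W(B)`. -/
def FormDominated (A : Matrix n n ℂ) (B : H →L[ℂ] H) : Prop :=
  ∀ (a : ℝ) (b : ℂ),
    (∀ x : n → ℂ, 0 ≤ a * (star x ⬝ᵥ x).re + 2 * (b * (star x ⬝ᵥ A *ᵥ x)).re) →
    ∀ h : H, 0 ≤ a * ‖h‖ ^ 2 + 2 * (b * inner ℂ h (B h)).re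

/-- `B` is a compression of `I ⊗ A`, in coordinates. -/
def HasCoordinateDilation (A : Matrix n n ℂ) (B : H →L[ℂ] H) : Prop :=
  ∃ (K : Type u) (_ : NormedAddCommGroup K) (_ : InnerProductSpace ℂ K) (_ : CompleteSpace K)
    (X : n → H →L[ℂ] K), ∀ h : H,
      ∑ i, (inner ℂ (X i h) (X i h) : ℂ) = inner ℂ h h ∧
      ∑ i, ∑ j, A i j * inner ℂ (X i h) (X j h) = inner ℂ h (B h)

theorem FormDominated.unitary_conj {A : Matrix n n ℂ} {B : H →L[ℂ] H} (hAB : FormDominated A B)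
    {U : Matrix n n ℂ} (hU : U * Uᴴ = 1) : FormDominated (Uᴴ * A * U) B := by
  intro a b hab
  refine hAB a b fun y => ?_
  have h := hab (Uᴴ *ᵥ y)
  have e : ∀ M : Matrix n n ℂ, star (Uᴴ *ᵥ y) ⬝ᵥ (Uᴴ * M * U) *ᵥ (Uᴴ *ᵥ y) = star y ⬝ᵥ M *ᵥ y := by
    intro M
    rw [star_mulVec, conjTranspose_conjTranspose, ← dotProduct_mulVec, mulVec_mulVec,
      mulVec_mulVec]
    congr 2
    calc U * (Uᴴ * M * U) * Uᴴ = (U * Uᴴ) * M * (U * Uᴴ) := by simp only [Matrix.mul_assoc]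
      _ = M := by rw [hU, Matrix.one_mul, Matrix.mul_one]
  have e1 : star (Uᴴ *ᵥ y) ⬝ᵥ (Uᴴ *ᵥ y) = star y ⬝ᵥ y := by
    have hU' : Uᴴ * U = 1 := mul_eq_one_comm.1 hU
    have := e 1
    rwa [Matrix.mul_one, hU', one_mulVec, one_mulVec] at this
  rwa [e, e1] at h

/-- Both sides are traces against the Gram matrix `G` of `v`: replacing `v` by `U v` replaces `G` by
`U G Uᴴ`, and the trace is cyclic. -/
theorem sum_mul_inner_unitary_conj {K : Type*} [NormedAddCommGroup K] [InnerProductSpace ℂ K]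
    {m : Type*} [Fintype m] (A U : Matrix m m ℂ) (v : m → K) :
    ∑ i, ∑ j, A i j * inner ℂ (∑ k, U i k • v k) (∑ k, U j k • v k) =
      ∑ i, ∑ j, (Uᴴ * A * U) i j * inner ℂ (v i) (v j) := by
  let G : Matrix m m ℂ := Matrix.of fun i j => inner ℂ (v j) (v i)
  have hG : ∀ M : Matrix m m ℂ, ∑ i, ∑ j, M i j * inner ℂ (v i) (v j) = (M * G).trace := by
    intro M
    simp [trace, Matrix.mul_apply, G]
  have hG' : ∀ i j, inner ℂ (∑ k, U i k • v k) (∑ k, U j k • v k) = (U * G * Uᴴ) j i := by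
    intro i j
    simp only [Matrix.mul_apply, conjTranspose_apply, sum_inner, inner_sum, inner_smul_left,
      inner_smul_right, G, Matrix.of_apply, Finset.sum_mul, Finset.mul_sum]
    rw [Finset.sum_comm]
    refine Finset.sum_congr rfl fun k _ => Finset.sum_congr rfl fun l _ => ?_
    simp only [RCLike.star_def]
    ring
  simp only [hG']
  rw [hG]
  have : ∑ i, ∑ j, A i j * (U * G * Uᴴ) j i = (A * (U * G * Uᴴ)).trace := by
    simp [trace, Matrix.mul_apply]
  rw [this, ← Matrix.mul_assoc, trace_mul_comm]
  simp only [Matrix.mul_assoc]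

theorem HasCoordinateDilation.of_unitary_conj {A : Matrix n n ℂ} {B : H →L[ℂ] H}
    {U : Matrix n n ℂ} (hU : U * Uᴴ = 1) (h : HasCoordinateDilation (Uᴴ * A * U) B) :
    HasCoordinateDilation A B := by
  obtain ⟨K, i1, i2, i3, X, hX⟩ := h
  refine ⟨K, i1, i2, i3, fun i => ∑ k, U i k • X k, fun h => ?_⟩
  have hU' : Uᴴ * U = 1 := mul_eq_one_comm.1 hU
  have e : ∀ i, (∑ k, U i k • X k) h = ∑ k, U i k • X k h := by
    intro i; simp
  simp only [e]
  constructor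
  · rw [← (hX h).1]
    have := sum_mul_inner_unitary_conj 1 U fun k => X k h
    rw [Matrix.mul_one, hU'] at this
    simpa only [Matrix.one_apply, ite_mul, one_mul, zero_mul, Finset.sum_ite_eq, Finset.mem_univ,
      if_true] using this
  · rw [sum_mul_inner_unitary_conj, (hX h).2]

/-- The real part of `r + 2 β B`. -/
noncomputable def affineRealPart [CompleteSpace H] (B : H →L[ℂ] H) (r : ℝ) (β : ℂ) : H →L[ℂ] H :=
  (r : ℂ) • (1 : H →L[ℂ] H) + β • B + (starRingEnd ℂ) β • ContinuousLinearMap.adjoint B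

theorem isSymmetric_affineRealPart [CompleteSpace H] (B : H →L[ℂ] H) (r : ℝ) (β : ℂ) (x y : H) :
    inner ℂ (affineRealPart B r β x) y = inner ℂ x (affineRealPart B r β y) := by
  simp only [affineRealPart, _root_.add_apply, _root_.smul_apply, inner_add_left, inner_add_right,
    inner_smul_left, inner_smul_right, ContinuousLinearMap.adjoint_inner_left,
    ContinuousLinearMap.adjoint_inner_right, Complex.conj_ofReal, Complex.conj_conj,
    one_apply_eq_self]
  ring

theorem reApplyInnerSelf_affineRealPart [CompleteSpace H] (B : H →L[ℂ] H) (r : ℝ) (β : ℂ)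
    (h : H) : (affineRealPart B r β).reApplyInnerSelf h =
      r * ‖h‖ ^ 2 + 2 * (β * inner ℂ h (B h)).re := by
  rw [ContinuousLinearMap.reApplyInnerSelf_apply, isSymmetric_affineRealPart]
  have e1 : (starRingEnd ℂ) β * inner ℂ (B h) h = (starRingEnd ℂ) (β * inner ℂ h (B h)) := by
    rw [map_mul, inner_conj_symm]
  have e2 : (inner ℂ h h).re = ‖h‖ ^ 2 := inner_self_eq_norm_sq (𝕜 := ℂ) _
  simp only [affineRealPart, _root_.add_apply, _root_.smul_apply, inner_add_right,
    inner_smul_right, ContinuousLinearMap.adjoint_inner_right, one_apply_eq_self, e1,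
    RCLike.re_eq_complex_re, Complex.add_re, Complex.conj_re, Complex.re_ofReal_mul, e2]
  ring

/-- The hypothesis is real linear independence of `o` and `d`; `b₁, b₂` form their dual basis for
the pairing `2 Re (b w)`. -/
theorem exists_dual_pair {o d : ℂ} (hod : (d * (starRingEnd ℂ) o).im ≠ 0) :
    ∃ b₁ b₂ : ℂ, 2 * (b₁ * o).re = 1 ∧ (b₁ * d).re = 0 ∧ (b₂ * o).re = 0 ∧
      2 * (b₂ * d).re = 1 := by
  have hδ : d.im * o.re - d.re * o.im ≠ 0 := by
    intro h
    apply hod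
    simp only [Complex.mul_im, Complex.conj_re, Complex.conj_im]
    linarith
  set δ := d.im * o.re - d.re * o.im
  refine ⟨⟨d.im / (2 * δ), d.re / (2 * δ)⟩, ⟨-o.im / (2 * δ), -o.re / (2 * δ)⟩, ?_, ?_, ?_, ?_⟩ <;>
    simp only [Complex.mul_re] <;> field_simp <;> ring

/-- The dual vectors `b₁, b₂` are independent over the reals, so they separate complex numbers. -/
theorem eq_of_dual_pair {o d b₁ b₂ w : ℂ} (h1 : 2 * (b₁ * o).re = 1) (h2 : (b₁ * d).re = 0)
    (h4 : 2 * (b₂ * d).re = 1) (hw1 : (b₁ * w).re = 0)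
    (hw2 : (b₂ * w).re = 0) : w = 0 := by
  simp only [Complex.mul_re] at *
  have hΔ : 4 * (b₁.im * b₂.re - b₁.re * b₂.im) * (o.re * d.im - o.im * d.re) = 1 := by
    linear_combination (2 * (b₂.re * d.re - b₂.im * d.im)) * h1 + h4 -
      4 * (b₂.re * o.re - b₂.im * o.im) * h2
  have hΔ' : b₁.im * b₂.re - b₁.re * b₂.im ≠ 0 := by
    intro h; rw [h] at hΔ; simp at hΔ
  apply Complex.ext
  · refine (mul_eq_zero.1 (?_ : (b₁.im * b₂.re - b₁.re * b₂.im) * w.re = 0)).resolve_left hΔ'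
    linear_combination b₁.im * hw2 - b₂.im * hw1
  · refine (mul_eq_zero.1 (?_ : (b₁.im * b₂.re - b₁.re * b₂.im) * w.im = 0)).resolve_left hΔ'
    linear_combination b₁.re * hw2 - b₂.re * hw1

/-- The values `n` and `z` of the forms of `I` and `B` are recovered from the values of the forms
of three affine functions of `B`. -/
theorem recover_values {s₀ s₁ o μ b₁ b₂ z : ℂ} {N G₀ G₁ g y : ℝ}
    (h1 : 2 * (b₁ * o).re = 1) (h2 : (b₁ * (s₀ - s₁)).re = 0)
    (h3 : (b₂ * o).re = 0) (h4 : 2 * (b₂ * (s₀ - s₁)).re = 1)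
    (hc : -(2 * (b₂ * s₁).re) * N + 2 * (b₂ * z).re =
      G₀ + (2 * (b₂ * (μ - s₁)).re) * y)
    (hb : -(2 * (b₁ * s₁).re) * N + 2 * (b₁ * z).re =
      2 * g + (2 * (b₁ * (μ - s₁)).re) * y)
    (ha : (1 + 2 * (b₂ * s₁).re) * N + 2 * (-b₂ * z).re =
      G₁ + (1 - 2 * (b₂ * (μ - s₁)).re) * y) :
    G₀ + G₁ + y = N ∧ s₀ * G₀ + s₁ * G₁ + 2 * o * g + μ * y = z := by
  have hN : G₀ + G₁ + y = N := by
    simp only [neg_mul, Complex.neg_re] at ha hc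
    linarith
  refine ⟨hN, ?_⟩
  rw [← sub_eq_zero]
  subst hN
  have e : ∀ b : ℂ, (b * (s₀ * G₀ + s₁ * G₁ + 2 * o * g + μ * y - z)).re =
      (b * (s₀ - s₁)).re * G₀ + (b * s₁).re * (G₀ + G₁ + y) + 2 * (b * o).re * g +
        (b * (μ - s₁)).re * y - (b * z).re := by
    intro b
    simp
    ring
  refine eq_of_dual_pair h1 h2 h4 ?_ ?_
  · rw [e, h1, h2]; linarith
  · rw [e, h3]; linear_combination (G₀ / 2) * h4 - hc / 2

theorem form_symmetric_fin_two (s₀ s₁ o : ℂ) (x : Fin 2 → ℂ) :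
    star x ⬝ᵥ !![s₀, o; o, s₁] *ᵥ x = s₀ * (Complex.normSq (x 0) : ℝ) +
      s₁ * (Complex.normSq (x 1) : ℝ) + 2 * o * ((star (x 0) * x 1).re : ℝ) := by
  have h0 : ((Complex.normSq (x 0) : ℝ) : ℂ) = star (x 0) * x 0 := Complex.normSq_eq_conj_mul_self
  have h1 : ((Complex.normSq (x 1) : ℝ) : ℂ) = star (x 1) * x 1 := Complex.normSq_eq_conj_mul_self
  have h2 : (((star (x 0) * x 1).re : ℝ) : ℂ) = (star (x 0) * x 1 + x 0 * star (x 1)) / 2 := by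
    rw [Complex.re_eq_add_conj]; simp
  rw [h0, h1, h2]
  simp [dotProduct, mulVec, Fin.sum_univ_two]
  ring

/-- By duality `b₂` produces `E₁₁`, `b₁` produces `E₁₂ + E₂₁`, and `I - E₁₁ = E₂₂`. The affine
function on the left therefore turns the symmetric matrix into the rank-one matrix with entries
`s²`, `s t`, `t²`. -/
theorem dual_form_eq_sq {s₀ s₁ o b₁ b₂ : ℂ} (h1 : 2 * (b₁ * o).re = 1)
    (h2 : (b₁ * (s₀ - s₁)).re = 0) (h3 : (b₂ * o).re = 0) (h4 : 2 * (b₂ * (s₀ - s₁)).re = 1)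
    (s t : ℝ) (x : Fin 2 → ℂ) :
    (t ^ 2 - 2 * ((s * t * b₁ + (s ^ 2 - t ^ 2) * b₂) * s₁).re) * (star x ⬝ᵥ x).re +
      2 * ((s * t * b₁ + (s ^ 2 - t ^ 2) * b₂) * (star x ⬝ᵥ !![s₀, o; o, s₁] *ᵥ x)).re =
      Complex.normSq (s * x 0 + t * x 1) := by
  rw [form_symmetric_fin_two]
  have e0 : (star x ⬝ᵥ x).re = Complex.normSq (x 0) + Complex.normSq (x 1) := by
    simp [dotProduct, Fin.sum_univ_two, Complex.normSq_apply]
  rw [e0]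
  have e1 : ∀ (β : ℂ) (p q r : ℝ), (β * (s₀ * p + s₁ * q + 2 * o * r)).re =
      (β * (s₀ - s₁)).re * p + (β * s₁).re * (p + q) + 2 * (β * o).re * r := by
    intro β p q r
    simp
    ring
  have e2 : ∀ w : ℂ, ((s * t * b₁ + (s ^ 2 - t ^ 2) * b₂) * w).re =
      s * t * (b₁ * w).re + (s ^ 2 - t ^ 2) * (b₂ * w).re := by
    intro w
    have : (s * t * b₁ + (s ^ 2 - t ^ 2) * b₂) * w =
      ((s * t : ℝ) : ℂ) * (b₁ * w) + ((s ^ 2 - t ^ 2 : ℝ) : ℂ) * (b₂ * w) := by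
      push_cast; ring
    rw [this, Complex.add_re, Complex.re_ofReal_mul, Complex.re_ofReal_mul]
  have e3 : Complex.normSq (s * x 0 + t * x 1) = s ^ 2 * Complex.normSq (x 0) +
      t ^ 2 * Complex.normSq (x 1) + 2 * (s * t) * (star (x 0) * x 1).re := by
    simp [Complex.normSq_apply]
    ring
  rw [e1, e3, e2, e2 (s₀ - s₁), e2 o, h2, h3]
  linear_combination (2 * s * t * (star (x 0) * x 1).re) * h1 +
    ((s ^ 2 - t ^ 2) * Complex.normSq (x 0)) * h4

end Compression

/-! ### Unitary normal forms of `2 × 2` matrices. -/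

section Compression

universe u

open Matrix

theorem exists_unitary_upper_triangular (A : Matrix (Fin 2) (Fin 2) ℂ) :
    ∃ U : Matrix (Fin 2) (Fin 2) ℂ, U * Uᴴ = 1 ∧ (Uᴴ * A * U) 1 0 = 0 := by
  obtain ⟨l, hl⟩ := Module.End.exists_eigenvalue (Matrix.toLin' A)
  obtain ⟨w, hw⟩ := hl.exists_hasEigenvector
  have hw1 : A *ᵥ w = l • w := by simpa using hw.apply_eq_smul
  have hw0 : w ≠ 0 := hw.2
  have hN : 0 < Complex.normSq (w 0) + Complex.normSq (w 1) := by
    by_contra hcon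
    apply hw0
    have h0 : Complex.normSq (w 0) = 0 := by
      linarith [Complex.normSq_nonneg (w 0), Complex.normSq_nonneg (w 1)]
    have h1 : Complex.normSq (w 1) = 0 := by
      linarith [Complex.normSq_nonneg (w 0), Complex.normSq_nonneg (w 1)]
    funext i
    fin_cases i
    · exact Complex.normSq_eq_zero.1 h0
    · exact Complex.normSq_eq_zero.1 h1
  obtain ⟨r, hr⟩ : ∃ r : ℝ, r ^ 2 * (Complex.normSq (w 0) + Complex.normSq (w 1)) = 1 := by
    refine ⟨(Real.sqrt (Complex.normSq (w 0) + Complex.normSq (w 1)))⁻¹, ?_⟩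
    rw [inv_pow, Real.sq_sqrt hN.le, inv_mul_cancel₀ hN.ne']
  have hrc : (r : ℂ) ^ 2 * (star (w 0) * w 0 + star (w 1) * w 1) = 1 := by
    have h0 : ((Complex.normSq (w 0) : ℝ) : ℂ) = star (w 0) * w 0 := Complex.normSq_eq_conj_mul_self
    have h1 : ((Complex.normSq (w 1) : ℝ) : ℂ) = star (w 1) * w 1 := Complex.normSq_eq_conj_mul_self
    rw [← h0, ← h1]
    exact_mod_cast hr
  have a0 : A 0 0 * w 0 + A 0 1 * w 1 = l * w 0 := by
    have := congrFun hw1 0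
    simpa [mulVec, dotProduct, Fin.sum_univ_two] using this
  have a1 : A 1 0 * w 0 + A 1 1 * w 1 = l * w 1 := by
    have := congrFun hw1 1
    simpa [mulVec, dotProduct, Fin.sum_univ_two] using this
  -- A normalized eigenvector, completed by the unit vector orthogonal to it.
  refine ⟨!![r * w 0, -(r * star (w 1)); r * w 1, r * star (w 0)], ?_, ?_⟩
  · ext i j
    fin_cases i <;> fin_cases j <;>
      simp [Matrix.mul_apply, Fin.sum_univ_two] <;>
      simp only [RCLike.star_def] at hrc <;>
      first | linear_combination hrc | ring
  · simp [Matrix.mul_apply, Fin.sum_univ_two]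
    linear_combination (-(r : ℂ) ^ 2 * w 1) * a0 + ((r : ℂ) ^ 2 * w 0) * a1

/-- Diagonalize the self-commutator, which is Hermitian, nonzero and of trace zero. Its diagonal is
`±(|M₀₁|² - |M₁₀|²)`, hence nonzero, while its vanishing off-diagonal entry would force `|M₀₁| =
|M₁₀|` if the diagonal entries of `M` differed. -/
theorem exists_unitary_equal_diagonal {A : Matrix (Fin 2) (Fin 2) ℂ}
    (hA : A * Aᴴ - Aᴴ * A ≠ 0) :
    ∃ U : Matrix (Fin 2) (Fin 2) ℂ, U * Uᴴ = 1 ∧ (Uᴴ * A * U) 0 0 = (Uᴴ * A * U) 1 1 ∧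
      Complex.normSq ((Uᴴ * A * U) 0 1) - Complex.normSq ((Uᴴ * A * U) 1 0) ≠ 0 := by
  have hC : (A * Aᴴ - Aᴴ * A).IsHermitian := by
    simp [Matrix.IsHermitian, Matrix.conjTranspose_sub, Matrix.conjTranspose_mul]
  let V : Matrix (Fin 2) (Fin 2) ℂ := hC.eigenvectorUnitary
  have hV : V * Vᴴ = 1 := Unitary.mul_star_self_of_mem hC.eigenvectorUnitary.2
  have hV' : Vᴴ * V = 1 := mul_eq_one_comm.1 hV
  let D : Matrix (Fin 2) (Fin 2) ℂ := Matrix.diagonal (RCLike.ofReal ∘ hC.eigenvalues)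
  have hD : A * Aᴴ - Aᴴ * A = V * D * Vᴴ := by
    conv_lhs => rw [hC.spectral_theorem]
    rfl
  have hD' : (Vᴴ * A * V) * (Vᴴ * A * V)ᴴ - (Vᴴ * A * V)ᴴ * (Vᴴ * A * V) = D := by
    have e1 : (Vᴴ * A * V)ᴴ = Vᴴ * Aᴴ * V := by
      simp [Matrix.conjTranspose_mul, Matrix.mul_assoc]
    have e2 : ∀ M N : Matrix (Fin 2) (Fin 2) ℂ, (Vᴴ * M * V) * (Vᴴ * N * V) =
        Vᴴ * (M * N) * V := by
      intro M N
      calc (Vᴴ * M * V) * (Vᴴ * N * V) = Vᴴ * M * (V * Vᴴ) * N * V := by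
            simp only [Matrix.mul_assoc]
        _ = _ := by rw [hV]; simp only [Matrix.mul_assoc, Matrix.one_mul]
    rw [e1, e2, e2, ← Matrix.sub_mul, ← Matrix.mul_sub, hD]
    calc Vᴴ * (V * D * Vᴴ) * V = (Vᴴ * V) * D * (Vᴴ * V) := by simp only [Matrix.mul_assoc]
      _ = D := by rw [hV', Matrix.one_mul, Matrix.mul_one]
  have hD0 : D ≠ 0 := by
    intro h
    apply hA
    rw [hD, h]; simp
  set M := Vᴴ * A * V with hM
  have d01 : (M 0 0 - M 1 1) * star (M 1 0) = star (M 0 0 - M 1 1) * M 0 1 := by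
    have := congrFun (congrFun hD' 0) 1
    simp [Matrix.mul_apply, Fin.sum_univ_two, D] at this
    simp only [star_sub, RCLike.star_def]
    linear_combination this
  have d00 : D 0 0 = (Complex.normSq (M 0 1) - Complex.normSq (M 1 0) : ℝ) := by
    rw [← hD']
    push_cast
    rw [Complex.normSq_eq_conj_mul_self, Complex.normSq_eq_conj_mul_self]
    simp [Matrix.mul_apply, Fin.sum_univ_two]
    ring
  have d11 : D 1 1 = -(Complex.normSq (M 0 1) - Complex.normSq (M 1 0) : ℝ) := by
    rw [← hD']
    push_cast
    rw [Complex.normSq_eq_conj_mul_self, Complex.normSq_eq_conj_mul_self]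
    simp [Matrix.mul_apply, Fin.sum_univ_two]
    ring
  have hne : Complex.normSq (M 0 1) - Complex.normSq (M 1 0) ≠ 0 := by
    intro h
    apply hD0
    rw [h] at d00 d11
    ext i j
    fin_cases i <;> fin_cases j
    · simpa using d00
    · simp [D]
    · simp [D]
    · simpa using d11
  refine ⟨V, hV, ?_, hne⟩
  by_contra hpq
  apply hne
  have h := congrArg Complex.normSq d01
  have hpos : Complex.normSq (M 0 0 - M 1 1) ≠ 0 := by
    rw [Ne, Complex.normSq_eq_zero, sub_eq_zero]; exact hpq
  simp only [Complex.normSq_mul, RCLike.star_def, Complex.normSq_conj] at h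
  rw [mul_right_inj' hpos] at h
  rw [h, sub_self]

/-- Every complex `2 × 2` matrix is unitarily equivalent to a diagonal matrix or to a nonnormal
symmetric matrix. -/
theorem exists_unitary_diagonal_or_symmetric (A : Matrix (Fin 2) (Fin 2) ℂ) :
    ∃ U : Matrix (Fin 2) (Fin 2) ℂ, U * Uᴴ = 1 ∧
      ((∃ α β : ℂ, Uᴴ * A * U = !![α, 0; 0, β]) ∨
        ∃ s₀ s₁ o : ℂ, ((s₀ - s₁) * (starRingEnd ℂ) o).im ≠ 0 ∧
          Uᴴ * A * U = !![s₀, o; o, s₁]) := by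
  by_cases hA : A * Aᴴ - Aᴴ * A = 0
  · obtain ⟨U, hU, h10⟩ := exists_unitary_upper_triangular A
    refine ⟨U, hU, Or.inl ⟨(Uᴴ * A * U) 0 0, (Uᴴ * A * U) 1 1, ?_⟩⟩
    have hN : (Uᴴ * A * U) * (Uᴴ * A * U)ᴴ - (Uᴴ * A * U)ᴴ * (Uᴴ * A * U) = 0 := by
      have e1 : (Uᴴ * A * U)ᴴ = Uᴴ * Aᴴ * U := by
        simp [Matrix.conjTranspose_mul, Matrix.mul_assoc]
      have e2 : ∀ M N : Matrix (Fin 2) (Fin 2) ℂ, (Uᴴ * M * U) * (Uᴴ * N * U) =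
          Uᴴ * (M * N) * U := by
        intro M N
        calc (Uᴴ * M * U) * (Uᴴ * N * U) = Uᴴ * M * (U * Uᴴ) * N * U := by
              simp only [Matrix.mul_assoc]
          _ = _ := by rw [hU]; simp only [Matrix.mul_assoc, Matrix.one_mul]
      rw [e1, e2, e2, ← Matrix.sub_mul, ← Matrix.mul_sub, hA]
      simp
    set M := Uᴴ * A * U
    -- A normal triangular matrix is diagonal: compare the corner entries of `M Mᴴ` and `Mᴴ M`.
    have h01 : M 0 1 = 0 := by
      have := congrFun (congrFun hN 0) 0
      simp [Matrix.mul_apply, Fin.sum_univ_two, h10] at this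
      have h2 : M 0 1 * (starRingEnd ℂ) (M 0 1) = 0 := by linear_combination this
      simpa using h2
    ext i j
    fin_cases i <;> fin_cases j <;> simp [h01, h10]
  · obtain ⟨V, hV, hd, hne⟩ := exists_unitary_equal_diagonal hA
    set M := Vᴴ * A * V with hM
    let r : ℝ := (Real.sqrt 2)⁻¹
    have hr : (r : ℂ) ^ 2 = 2⁻¹ := by
      have : r ^ 2 = 2⁻¹ := by simp only [r]; rw [inv_pow, Real.sq_sqrt (by norm_num)]
      have h2 := congrArg (fun x : ℝ => (x : ℂ)) this
      push_cast at h2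
      exact h2
    -- The columns `(1, 1) / √2` and `i (1, -1) / √2` make a matrix with equal diagonal entries
    -- symmetric; the factor `i` equalizes the two off-diagonal entries.
    let W : Matrix (Fin 2) (Fin 2) ℂ := !![(r : ℂ), r * Complex.I; (r : ℂ), -(r * Complex.I)]
    have hW : W * Wᴴ = 1 := by
      ext i j
      fin_cases i <;> fin_cases j <;>
        simp [W, Matrix.mul_apply, Fin.sum_univ_two] <;>
        ring_nf <;> simp [hr] <;> norm_num
    refine ⟨V * W, ?_, Or.inr ⟨M 0 0 + (M 0 1 + M 1 0) / 2, M 0 0 - (M 0 1 + M 1 0) / 2,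
      -(Complex.I * (M 0 1 - M 1 0)) / 2, ?_, ?_⟩⟩
    · rw [Matrix.conjTranspose_mul]
      calc V * W * (Wᴴ * Vᴴ) = V * (W * Wᴴ) * Vᴴ := by simp only [Matrix.mul_assoc]
        _ = 1 := by rw [hW, Matrix.mul_one, hV]
    · have e : ((M 0 0 + (M 0 1 + M 1 0) / 2 - (M 0 0 - (M 0 1 + M 1 0) / 2)) *
          (starRingEnd ℂ) (-(Complex.I * (M 0 1 - M 1 0)) / 2)).im =
          (Complex.normSq (M 0 1) - Complex.normSq (M 1 0)) / 2 := by
        have e1 : M 0 0 + (M 0 1 + M 1 0) / 2 - (M 0 0 - (M 0 1 + M 1 0) / 2) =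
          M 0 1 + M 1 0 := by ring
        have e2 : (starRingEnd ℂ) (-(Complex.I * (M 0 1 - M 1 0)) / 2) =
          ((2⁻¹ : ℝ) : ℂ) * (Complex.I * (starRingEnd ℂ) (M 0 1 - M 1 0)) := by
          rw [map_div₀, map_ofNat]; simp; ring
        rw [e1, e2]
        simp [Complex.normSq_apply]
        ring
      rw [e]
      exact div_ne_zero hne two_ne_zero
    · have e : (V * W)ᴴ * A * (V * W) = Wᴴ * M * W := by
        rw [hM, Matrix.conjTranspose_mul]; simp only [Matrix.mul_assoc]
      rw [e]
      ext i j
      fin_cases i <;> fin_cases j <;>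
        simp [W, Matrix.mul_apply, Fin.sum_univ_two] <;> rw [← hd] <;> ring_nf <;>
        simp [hr] <;> ring

end Compression

/-! ### Dilations in the nonnormal symmetric case. -/

section Compression

universe u

open Matrix

variable {H : Type u} [NormedAddCommGroup H] [InnerProductSpace ℂ H]

theorem inner_self_re_eq_norm_sq (h : H) : (inner ℂ h h : ℂ) = ((‖h‖ ^ 2 : ℝ) : ℂ) := by
  rw [inner_self_eq_norm_sq_to_K]; simp

theorem HasCoordinateDilation.directSumScalar {A : Matrix (Fin 2) (Fin 2) ℂ} {B : H →L[ℂ] H}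
    (μ : ℂ) {K : Type u} [NormedAddCommGroup K] [InnerProductSpace ℂ K] [CompleteSpace K]
    (X₀ X₁ Y : H →L[ℂ] K) (h : ∀ h : H,
      ‖X₀ h‖ ^ 2 + ‖X₁ h‖ ^ 2 + ‖Y h‖ ^ 2 = ‖h‖ ^ 2 ∧
      A 0 0 * (‖X₀ h‖ ^ 2 : ℝ) + A 1 1 * (‖X₁ h‖ ^ 2 : ℝ) + A 0 1 * inner ℂ (X₀ h) (X₁ h) +
        A 1 0 * inner ℂ (X₁ h) (X₀ h) + μ * (‖Y h‖ ^ 2 : ℝ) = inner ℂ h (B h)) :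
    HasCoordinateDilation (directSumScalar A μ) B := by
  refine ⟨K, inferInstance, inferInstance, inferInstance, Sum.elim ![X₀, X₁] fun _ => Y,
    fun x => ⟨?_, ?_⟩⟩
  · rw [inner_self_re_eq_norm_sq x, ← (h x).1]
    simp only [Fintype.sum_sum_type, Fin.sum_univ_two, inner_self_re_eq_norm_sq]
    simp
  · rw [← (h x).2]
    simp only [Fintype.sum_sum_type, Fin.sum_univ_two, NumericalRangeDilation.directSumScalar,
      Sum.elim_inl, Sum.elim_inr, fromBlocks_apply₁₁, fromBlocks_apply₁₂, fromBlocks_apply₂₁,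
      fromBlocks_apply₂₂, Finset.univ_unique, Finset.sum_singleton]
    simp only [Matrix.cons_val_zero, Matrix.cons_val_one, inner_self_re_eq_norm_sq]
    simp
    ring

theorem HasCoordinateDilation.fin_two {A : Matrix (Fin 2) (Fin 2) ℂ} {B : H →L[ℂ] H}
    {K : Type u} [NormedAddCommGroup K] [InnerProductSpace ℂ K] [CompleteSpace K]
    (X₀ X₁ : H →L[ℂ] K) (h : ∀ h : H,
      ‖X₀ h‖ ^ 2 + ‖X₁ h‖ ^ 2 = ‖h‖ ^ 2 ∧
      A 0 0 * (‖X₀ h‖ ^ 2 : ℝ) + A 1 1 * (‖X₁ h‖ ^ 2 : ℝ) + A 0 1 * inner ℂ (X₀ h) (X₁ h) +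
        A 1 0 * inner ℂ (X₁ h) (X₀ h) = inner ℂ h (B h)) :
    HasCoordinateDilation A B := by
  refine ⟨K, inferInstance, inferInstance, inferInstance, ![X₀, X₁], fun x => ⟨?_, ?_⟩⟩
  · rw [inner_self_re_eq_norm_sq x, ← (h x).1]
    simp only [Fin.sum_univ_two, inner_self_re_eq_norm_sq]
    simp
  · rw [← (h x).2]
    simp only [Fin.sum_univ_two, Matrix.cons_val_zero, Matrix.cons_val_one,
      inner_self_re_eq_norm_sq]
    ring

theorem form_directSumScalar (A : Matrix (Fin 2) (Fin 2) ℂ) (μ : ℂ) (x : Fin 2 ⊕ Fin 1 → ℂ) :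
    star x ⬝ᵥ directSumScalar A μ *ᵥ x =
      star (x ∘ Sum.inl) ⬝ᵥ A *ᵥ (x ∘ Sum.inl) + μ * (Complex.normSq (x (Sum.inr 0)) : ℝ) := by
  have h1 : ((Complex.normSq (x (Sum.inr 0)) : ℝ) : ℂ) = star (x (Sum.inr 0)) * x (Sum.inr 0) :=
    Complex.normSq_eq_conj_mul_self
  rw [h1]
  simp [dotProduct, mulVec, Fin.sum_univ_two, directSumScalar]
  ring

theorem re_dotProduct_star_sum (x : Fin 2 ⊕ Fin 1 → ℂ) :
    (star x ⬝ᵥ x).re =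
      (star (x ∘ Sum.inl) ⬝ᵥ (x ∘ Sum.inl)).re + Complex.normSq (x (Sum.inr 0)) := by
  simp [dotProduct, Fin.sum_univ_two, Complex.normSq_apply]

theorem form_diagonal_fin_two (α β : ℂ) (x : Fin 2 → ℂ) :
    star x ⬝ᵥ !![α, 0; 0, β] *ᵥ x =
      α * (Complex.normSq (x 0) : ℝ) + β * (Complex.normSq (x 1) : ℝ) := by
  rw [form_symmetric_fin_two]; simp

theorem re_dotProduct_star_fin_two (x : Fin 2 → ℂ) :
    (star x ⬝ᵥ x).re = Complex.normSq (x 0) + Complex.normSq (x 1) := by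
  simp [dotProduct, Fin.sum_univ_two, Complex.normSq_apply]

variable [CompleteSpace H]

section Symmetric

variable {s₀ s₁ o b₁ b₂ : ℂ} (B : H →L[ℂ] H)

/-- The counterpart at `B` of `dual_form_eq_sq`: the scalars are the same, so `FormDominated`
carries positivity over to the pencil. -/
theorem reApplyInnerSelf_pencil (s t : ℝ) (h : H) :
    s ^ 2 * (affineRealPart B (-(2 * (b₂ * s₁).re)) b₂).reApplyInnerSelf h +
      s * t * (affineRealPart B (-(2 * (b₁ * s₁).re)) b₁).reApplyInnerSelf h +
      t ^ 2 * (affineRealPart B (1 + 2 * (b₂ * s₁).re) (-b₂)).reApplyInnerSelf h =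
    (t ^ 2 - 2 * ((s * t * b₁ + (s ^ 2 - t ^ 2) * b₂) * s₁).re) * ‖h‖ ^ 2 +
      2 * ((s * t * b₁ + (s ^ 2 - t ^ 2) * b₂) * inner ℂ h (B h)).re := by
  have e2 : ∀ w : ℂ, ((s * t * b₁ + (s ^ 2 - t ^ 2) * b₂) * w).re =
      s * t * (b₁ * w).re + (s ^ 2 - t ^ 2) * (b₂ * w).re := by
    intro w
    have : (s * t * b₁ + (s ^ 2 - t ^ 2) * b₂) * w =
      ((s * t : ℝ) : ℂ) * (b₁ * w) + ((s ^ 2 - t ^ 2 : ℝ) : ℂ) * (b₂ * w) := by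
      push_cast; ring
    rw [this, Complex.add_re, Complex.re_ofReal_mul, Complex.re_ofReal_mul]
  rw [e2, e2]
  simp only [reApplyInnerSelf_affineRealPart, neg_mul, Complex.neg_re]
  ring

theorem symmetric_form_value (G₀ G₁ : ℝ) (z y : ℂ) (w : ℂ) (hzy : (starRingEnd ℂ) z = w) :
    s₀ * G₀ + s₁ * G₁ + o * z + o * w + y = s₀ * G₀ + s₁ * G₁ + 2 * o * (z.re : ℝ) + y := by
  have h2 : ((z.re : ℝ) : ℂ) = (z + w) / 2 := by
    rw [Complex.re_eq_add_conj, hzy]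
  rw [h2]; ring

theorem hasCoordinateDilation_symmetric (hne : ((s₀ - s₁) * (starRingEnd ℂ) o).im ≠ 0)
    (hB : FormDominated !![s₀, o; o, s₁] B) : HasCoordinateDilation !![s₀, o; o, s₁] B := by
  obtain ⟨b₁, b₂, h1, h2, h3, h4⟩ := exists_dual_pair hne
  obtain ⟨K, i1, i2, i3, Z₀, Z₁, Y, hZ⟩ := hasQuadraticFactorization_of_nonneg
    (affineRealPart B (-(2 * (b₂ * s₁).re)) b₂) (affineRealPart B (-(2 * (b₁ * s₁).re)) b₁)
    (affineRealPart B (1 + 2 * (b₂ * s₁).re) (-b₂)) (isSymmetric_affineRealPart _ _ _)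
    (isSymmetric_affineRealPart _ _ _) (isSymmetric_affineRealPart _ _ _) 0 0 0 (by
      intro s t h
      rw [reApplyInnerSelf_pencil]
      refine hB _ _ (fun x => ?_) h
      rw [dual_form_eq_sq h1 h2 h3 h4]
      exact Complex.normSq_nonneg _)
  refine .fin_two Z₀ Z₁ fun h => ?_
  obtain ⟨hc, hb, ha⟩ := hZ h
  simp only [reApplyInnerSelf_affineRealPart] at ha hb hc
  obtain ⟨hN, hz⟩ := recover_values (o := o) (μ := 0) (y := 0)
    (G₀ := ‖Z₀ h‖ ^ 2) (G₁ := ‖Z₁ h‖ ^ 2) h1 h2 h3 h4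
    (by rw [hc]; ring) (by rw [hb]; ring) (by rw [ha]; ring)
  refine ⟨by linarith, ?_⟩
  rw [← hz]
  have := symmetric_form_value (s₀ := s₀) (s₁ := s₁) (o := o) (‖Z₀ h‖ ^ 2) (‖Z₁ h‖ ^ 2)
    (inner ℂ (Z₀ h) (Z₁ h)) 0 _ (inner_conj_symm _ _)
  simpa using this

theorem hasCoordinateDilation_symmetric_directSumScalar (μ : ℂ)
    (hne : ((s₀ - s₁) * (starRingEnd ℂ) o).im ≠ 0)
    (hB : FormDominated (directSumScalar !![s₀, o; o, s₁] μ) B) :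
    HasCoordinateDilation (directSumScalar !![s₀, o; o, s₁] μ) B := by
  obtain ⟨b₁, b₂, h1, h2, h3, h4⟩ := exists_dual_pair hne
  obtain ⟨K, i1, i2, i3, Z₀, Z₁, Y, hZ⟩ := hasQuadraticFactorization_of_trace_eq_one
    (affineRealPart B (-(2 * (b₂ * s₁).re)) b₂) (affineRealPart B (-(2 * (b₁ * s₁).re)) b₁)
    (affineRealPart B (1 + 2 * (b₂ * s₁).re) (-b₂)) (isSymmetric_affineRealPart _ _ _)
    (isSymmetric_affineRealPart _ _ _) (isSymmetric_affineRealPart _ _ _)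
    -- The values at `μ` of the affine functions that give `E₁₁`, half of `E₁₂ + E₂₁`, and `E₂₂`.
    -- The first and last functions sum to `1`, hence trace one.
    (2 * (b₂ * (μ - s₁)).re) (b₁ * (μ - s₁)).re (1 - 2 * (b₂ * (μ - s₁)).re) (by ring) (by
      intro s t hst h
      rw [reApplyInnerSelf_pencil]
      refine hB _ _ (fun x => ?_) h
      have e := dual_form_eq_sq h1 h2 h3 h4 s t (x ∘ Sum.inl)
      have e2 : (t ^ 2 - 2 * ((s * t * b₁ + (s ^ 2 - t ^ 2) * b₂) * s₁).re) +
          2 * ((s * t * b₁ + (s ^ 2 - t ^ 2) * b₂) * μ).re =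
          2 * (b₂ * (μ - s₁)).re * s ^ 2 + 2 * (b₁ * (μ - s₁)).re * (s * t) +
            (1 - 2 * (b₂ * (μ - s₁)).re) * t ^ 2 := by
        have : (s * t * b₁ + (s ^ 2 - t ^ 2) * b₂) * (μ - s₁) =
          ((s * t : ℝ) : ℂ) * (b₁ * (μ - s₁)) + ((s ^ 2 - t ^ 2 : ℝ) : ℂ) * (b₂ * (μ - s₁)) := by
          push_cast; ring
        have h' := congrArg Complex.re this
        rw [Complex.add_re, Complex.re_ofReal_mul, Complex.re_ofReal_mul, mul_sub,
          Complex.sub_re] at h'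
        linear_combination 2 * h'
      rw [form_directSumScalar, re_dotProduct_star_sum, mul_add _ _ (μ * _), Complex.add_re,
        ← mul_assoc _ μ, Complex.re_mul_ofReal]
      have p1 := Complex.normSq_nonneg (s * (x ∘ Sum.inl) 0 + t * (x ∘ Sum.inl) 1)
      rw [← e] at p1
      rw [← e2] at hst
      have p2 := mul_nonneg hst (Complex.normSq_nonneg (x (Sum.inr 0)))
      linarith)
  refine .directSumScalar μ Z₀ Z₁ Y fun h => ?_
  obtain ⟨hc, hb, ha⟩ := hZ h
  simp only [reApplyInnerSelf_affineRealPart] at ha hb hc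
  obtain ⟨hN, hz⟩ := recover_values (o := o) (μ := μ) (y := ‖Y h‖ ^ 2) h1 h2 h3 h4 hc hb ha
  refine ⟨by linarith, ?_⟩
  rw [← hz]
  have := symmetric_form_value (s₀ := s₀) (s₁ := s₁) (o := o) (‖Z₀ h‖ ^ 2) (‖Z₁ h‖ ^ 2)
    (inner ℂ (Z₀ h) (Z₁ h)) (μ * (‖Y h‖ ^ 2 : ℝ)) _ (inner_conj_symm _ _)
  simpa using this

end Symmetric

end Compression

/-! ### Dilations in the diagonal case, and reduction to normal forms. -/

section Compression

universe u

open Matrix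

variable {H : Type u} [NormedAddCommGroup H] [InnerProductSpace ℂ H] [CompleteSpace H]

theorem exists_norm_sq_eq_affineRealPart (B : H →L[ℂ] H) (r : ℝ) (β : ℂ)
    (hpos : ∀ h : H, 0 ≤ r * ‖h‖ ^ 2 + 2 * (β * inner ℂ h (B h)).re) :
    ∃ X : H →L[ℂ] H, ∀ h : H, ‖X h‖ ^ 2 = r * ‖h‖ ^ 2 + 2 * (β * inner ℂ h (B h)).re := by
  have hT : (affineRealPart B r β).IsPositive := by
    refine ⟨fun x y => isSymmetric_affineRealPart B r β x y, fun h => ?_⟩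
    rw [reApplyInnerSelf_affineRealPart]
    exact hpos h
  obtain ⟨X, hX⟩ := CStarAlgebra.nonneg_iff_eq_star_mul_self.1
    ((ContinuousLinearMap.nonneg_iff_isPositive _).2 hT)
  refine ⟨X, fun h => ?_⟩
  rw [← reApplyInnerSelf_affineRealPart, hX, ContinuousLinearMap.reApplyInnerSelf_apply,
    ContinuousLinearMap.star_eq_adjoint]
  rw [mul_apply_eq_comp, ContinuousLinearMap.adjoint_inner_left]
  exact (inner_self_eq_norm_sq (𝕜 := ℂ) _).symm

/-- `(B - α) / (β - α)` is a positive contraction; it and its complement have the form `X* X`. -/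
theorem exists_decomposition_of_segment (α β : ℂ) (B : H →L[ℂ] H)
    (hB : ∀ (a : ℝ) (b : ℂ), 0 ≤ a + 2 * (b * α).re → 0 ≤ a + 2 * (b * β).re →
      ∀ h : H, 0 ≤ a * ‖h‖ ^ 2 + 2 * (b * inner ℂ h (B h)).re) :
    ∃ X₀ X₁ : H →L[ℂ] H, ∀ h : H, ‖X₀ h‖ ^ 2 + ‖X₁ h‖ ^ 2 = ‖h‖ ^ 2 ∧
      α * (‖X₀ h‖ ^ 2 : ℝ) + β * (‖X₁ h‖ ^ 2 : ℝ) = inner ℂ h (B h) := by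
  rcases eq_or_ne α β with rfl | hne
  -- A one-point segment: testing all directions `b` shows that `B` has the form of `α I`.
  · refine ⟨1, 0, fun h => ⟨by simp, ?_⟩⟩
    have key : ∀ b : ℂ, 0 ≤ (b * (inner ℂ h (B h) - α * (‖h‖ ^ 2 : ℝ))).re := by
      intro b
      have := hB (-(2 * (b * α).re)) b (by linarith) (by linarith) h
      rw [mul_sub, Complex.sub_re, ← mul_assoc, Complex.re_mul_ofReal]
      linarith
    have e : inner ℂ h (B h) - α * (‖h‖ ^ 2 : ℝ) = 0 := by
      have k1 := key 1
      have k2 := key (-1)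
      have k3 := key Complex.I
      have k4 := key (-Complex.I)
      simp only [one_mul, neg_mul, Complex.neg_re, Complex.I_mul_re] at k1 k2 k3 k4
      exact Complex.ext (by rw [Complex.zero_re]; linarith) (by rw [Complex.zero_im]; linarith)
    simp only [one_apply_eq_self, _root_.zero_apply, norm_zero]
    rw [← sub_eq_zero.1 e]
    simp
  · have hd : β - α ≠ 0 := sub_ne_zero.2 hne.symm
    set e := (β - α)⁻¹ with he
    have heβ : e * β = e * α + 1 := by
      have : e * (β - α) = 1 := inv_mul_cancel₀ hd
      linear_combination this
    -- The functionals `± Re (i e ·)` are constant on the line through `α` and `β`, so testing both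
    -- signs puts the form of `B` on that line.
    have him : ∀ h : H, (e * (inner ℂ h (B h) - α * (‖h‖ ^ 2 : ℝ))).im = 0 := by
      intro h
      have k1 := hB (-(2 * (Complex.I * e * α).re)) (Complex.I * e) (by linarith) (by
        rw [mul_assoc, mul_assoc, heβ]; simp) h
      have k2 := hB (2 * (Complex.I * e * α).re) (-(Complex.I * e)) (by
        rw [neg_mul, Complex.neg_re]; linarith) (by
        rw [neg_mul, mul_assoc, mul_assoc, heβ]; simp; linarith) h
      have e1 : ∀ w : ℂ, (Complex.I * e * w).re = -(e * w).im := by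
        intro w; rw [mul_assoc, Complex.I_mul_re]
      rw [neg_mul, Complex.neg_re, e1, e1] at k2
      rw [e1, e1] at k1
      rw [mul_sub, Complex.sub_im, ← mul_assoc, Complex.im_mul_ofReal]
      linarith
    have h2 : ∀ w : ℂ, 2 * (e / 2 * w).re = (e * w).re := by
      intro w
      have : e / 2 * w = ((2⁻¹ : ℝ) : ℂ) * (e * w) := by push_cast; ring
      rw [this, Complex.re_ofReal_mul]; ring
    have h2' : ∀ w : ℂ, 2 * (-(e / 2) * w).re = -(e * w).re := by
      intro w
      rw [neg_mul, Complex.neg_re, ← h2]; ring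
    obtain ⟨X₁, hX₁⟩ := exists_norm_sq_eq_affineRealPart B (-(e * α).re) (e / 2) (hB _ _ (by
      rw [h2]; linarith) (by rw [h2, heβ]; simp; linarith))
    obtain ⟨X₀, hX₀⟩ := exists_norm_sq_eq_affineRealPart B (1 + (e * α).re) (-(e / 2)) (hB _ _ (by
      rw [h2']; linarith) (by rw [h2', heβ]; simp; linarith))
    refine ⟨X₀, X₁, fun h => ?_⟩
    have hsum : ‖X₀ h‖ ^ 2 + ‖X₁ h‖ ^ 2 = ‖h‖ ^ 2 := by
      rw [hX₀, hX₁, h2, h2']; ring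
    refine ⟨hsum, ?_⟩
    have hx : ((‖X₁ h‖ ^ 2 : ℝ) : ℂ) = e * (inner ℂ h (B h) - α * (‖h‖ ^ 2 : ℝ)) := by
      apply Complex.ext
      · rw [hX₁, h2, Complex.ofReal_re, mul_sub, Complex.sub_re, ← mul_assoc,
          Complex.re_mul_ofReal]
        ring
      · rw [him, Complex.ofReal_im]
    have h0 : ((‖X₀ h‖ ^ 2 : ℝ) : ℂ) = (‖h‖ ^ 2 : ℝ) - (‖X₁ h‖ ^ 2 : ℝ) := by
      rw [← hsum]; push_cast; ring
    rw [h0]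
    have : (β - α) * e = 1 := mul_inv_cancel₀ hd
    rw [hx]
    linear_combination (inner ℂ h (B h) - α * (‖h‖ ^ 2 : ℝ)) * this

/-- The three barycentric coordinates are affine functions nonnegative at the vertices, so they are
positive at `B` and have the form `X* X`. If the vertices are collinear, one lies between the other
two and is dropped. -/
theorem exists_decomposition_of_triangle (α β μ : ℂ) (B : H →L[ℂ] H)
    (hB : ∀ (a : ℝ) (b : ℂ), 0 ≤ a + 2 * (b * α).re → 0 ≤ a + 2 * (b * β).re →
      0 ≤ a + 2 * (b * μ).re → ∀ h : H, 0 ≤ a * ‖h‖ ^ 2 + 2 * (b * inner ℂ h (B h)).re) :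
    ∃ X₀ X₁ X₂ : H →L[ℂ] H, ∀ h : H, ‖X₀ h‖ ^ 2 + ‖X₁ h‖ ^ 2 + ‖X₂ h‖ ^ 2 = ‖h‖ ^ 2 ∧
      α * (‖X₀ h‖ ^ 2 : ℝ) + β * (‖X₁ h‖ ^ 2 : ℝ) + μ * (‖X₂ h‖ ^ 2 : ℝ) = inner ℂ h (B h) := by
  by_cases hcol : ((μ - α) * (starRingEnd ℂ) (β - α)).im = 0
  · have hcases : (∃ r : ℝ, 0 ≤ r ∧ r ≤ 1 ∧ α = (1 - r) * β + r * μ) ∨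
        (∃ r : ℝ, 0 ≤ r ∧ r ≤ 1 ∧ β = (1 - r) * α + r * μ) ∨
        (∃ r : ℝ, 0 ≤ r ∧ r ≤ 1 ∧ μ = (1 - r) * α + r * β) := by
      rcases eq_or_ne β α with rfl | hne
      · exact Or.inl ⟨0, le_rfl, zero_le_one, by simp⟩
      have hd : β - α ≠ 0 := sub_ne_zero.2 hne
      obtain ⟨r, hr⟩ : ∃ r : ℝ, μ - α = r * (β - α) := by
        refine ⟨((μ - α) * (starRingEnd ℂ) (β - α)).re / Complex.normSq (β - α), ?_⟩
        have e1 : ((((μ - α) * (starRingEnd ℂ) (β - α)).re : ℝ) : ℂ) =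
            (μ - α) * (starRingEnd ℂ) (β - α) :=
          Complex.ext rfl (by rw [hcol, Complex.ofReal_im])
        rw [Complex.ofReal_div, e1, ← Complex.mul_conj]
        have hd' : (starRingEnd ℂ) (β - α) ≠ 0 := (map_ne_zero _).2 hd
        field_simp
      rcases lt_or_ge r 0 with h0 | h0
      · have hr0 : (1 - (r : ℂ)) ≠ 0 := by
          have : (1 - r) ≠ 0 := by linarith
          exact_mod_cast this
        refine Or.inl ⟨(1 - r)⁻¹, inv_nonneg.2 (by linarith), inv_le_one_of_one_le₀ (by linarith), ?_⟩
        push_cast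
        field_simp
        linear_combination -hr
      · rcases le_or_gt r 1 with h1 | h1
        · exact Or.inr (Or.inr ⟨r, h0, h1, by linear_combination hr⟩)
        · have hr0 : (r : ℂ) ≠ 0 := by
            have : r ≠ 0 := by linarith
            exact_mod_cast this
          refine Or.inr (Or.inl ⟨r⁻¹, inv_nonneg.2 h0, inv_le_one_of_one_le₀ h1.le, ?_⟩)
          push_cast
          field_simp
          linear_combination -hr
    have hconv : ∀ (a : ℝ) (b x y z : ℂ) (r : ℝ), 0 ≤ r → r ≤ 1 → z = (1 - r) * x + r * y →
        0 ≤ a + 2 * (b * x).re → 0 ≤ a + 2 * (b * y).re → 0 ≤ a + 2 * (b * z).re := by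
      intro a b x y z r h0 h1 hz hx hy
      have e : (b * z).re = (1 - r) * (b * x).re + r * (b * y).re := by
        have : b * z = ((1 - r : ℝ) : ℂ) * (b * x) + (r : ℂ) * (b * y) := by
          rw [hz]; push_cast; ring
        rw [this, Complex.add_re, Complex.re_ofReal_mul, Complex.re_ofReal_mul]
      rw [e]
      have := mul_nonneg (sub_nonneg.2 h1) hx
      have := mul_nonneg h0 hy
      linarith
    rcases hcases with ⟨r, h0, h1, hr⟩ | ⟨r, h0, h1, hr⟩ | ⟨r, h0, h1, hr⟩
    · obtain ⟨X₀, X₁, hX⟩ := exists_decomposition_of_segment β μ B fun a b hx hy =>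
        hB a b (hconv a b _ _ _ r h0 h1 hr hx hy) hx hy
      refine ⟨0, X₀, X₁, fun h => ⟨?_, ?_⟩⟩
      · rw [← (hX h).1]; simp
      · rw [← (hX h).2]; simp
    · obtain ⟨X₀, X₁, hX⟩ := exists_decomposition_of_segment α μ B fun a b hx hy =>
        hB a b hx (hconv a b _ _ _ r h0 h1 hr hx hy) hy
      refine ⟨X₀, 0, X₁, fun h => ⟨?_, ?_⟩⟩
      · rw [← (hX h).1]; simp
      · rw [← (hX h).2]; simp
    · obtain ⟨X₀, X₁, hX⟩ := exists_decomposition_of_segment α β B fun a b hx hy =>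
        hB a b hx hy (hconv a b _ _ _ r h0 h1 hr hx hy)
      refine ⟨X₀, X₁, 0, fun h => ⟨?_, ?_⟩⟩
      · rw [← (hX h).1]; simp
      · rw [← (hX h).2]; simp
  · obtain ⟨b₁, b₂, h1, h2, h3, h4⟩ := exists_dual_pair hcol
    rw [mul_sub, Complex.sub_re] at h1 h2 h3 h4
    obtain ⟨X₁, hX₁⟩ := exists_norm_sq_eq_affineRealPart B (-(2 * (b₁ * α).re)) b₁
      (hB _ _ (by linarith) (by linarith) (by linarith))
    obtain ⟨X₂, hX₂⟩ := exists_norm_sq_eq_affineRealPart B (-(2 * (b₂ * α).re)) b₂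
      (hB _ _ (by linarith) (by linarith) (by linarith))
    have hadd : ∀ w : ℂ, (-(b₁ + b₂) * w).re = -(b₁ * w).re - (b₂ * w).re := by
      intro w
      rw [show -(b₁ + b₂) * w = -(b₁ * w) - b₂ * w by ring, Complex.sub_re, Complex.neg_re]
    obtain ⟨X₀, hX₀⟩ := exists_norm_sq_eq_affineRealPart B
      (1 + 2 * (b₁ * α).re + 2 * (b₂ * α).re) (-(b₁ + b₂))
      (hB _ _ (by rw [hadd]; linarith) (by rw [hadd]; linarith) (by rw [hadd]; linarith))
    refine ⟨X₀, X₁, X₂, fun h => ?_⟩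
    have hsum : ‖X₀ h‖ ^ 2 + ‖X₁ h‖ ^ 2 + ‖X₂ h‖ ^ 2 = ‖h‖ ^ 2 := by
      rw [hX₀, hX₁, hX₂, hadd]; ring
    refine ⟨hsum, ?_⟩
    rw [← sub_eq_zero]
    have hexp : ∀ b : ℂ, (b * (α * (‖X₀ h‖ ^ 2 : ℝ) + β * (‖X₁ h‖ ^ 2 : ℝ) +
        μ * (‖X₂ h‖ ^ 2 : ℝ) - inner ℂ h (B h))).re = (b * α).re * ‖X₀ h‖ ^ 2 +
          (b * β).re * ‖X₁ h‖ ^ 2 + (b * μ).re * ‖X₂ h‖ ^ 2 - (b * inner ℂ h (B h)).re := by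
      intro b
      rw [mul_sub, mul_add, mul_add, Complex.sub_re, Complex.add_re, Complex.add_re,
        ← mul_assoc, ← mul_assoc, ← mul_assoc, Complex.re_mul_ofReal, Complex.re_mul_ofReal,
        Complex.re_mul_ofReal]
    refine eq_of_dual_pair (o := β - α) (d := μ - α) (b₁ := b₁) (b₂ := b₂) ?_ ?_ ?_ ?_ ?_
    · rw [mul_sub, Complex.sub_re]; exact h1
    · rw [mul_sub, Complex.sub_re]; exact h2
    · rw [mul_sub, Complex.sub_re]; exact h4
    · rw [hexp]
      linear_combination (‖X₁ h‖ ^ 2 / 2) * h1 + ‖X₂ h‖ ^ 2 * h2 + (b₁ * α).re * hsum + hX₁ h / 2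
    · rw [hexp]
      linear_combination ‖X₁ h‖ ^ 2 * h3 + (‖X₂ h‖ ^ 2 / 2) * h4 + (b₂ * α).re * hsum + hX₂ h / 2

theorem hasCoordinateDilation_diagonal {α β : ℂ} (B : H →L[ℂ] H)
    (hB : FormDominated !![α, 0; 0, β] B) : HasCoordinateDilation !![α, 0; 0, β] B := by
  obtain ⟨X₀, X₁, hX⟩ := exists_decomposition_of_segment α β B fun a b hα hβ h => by
    refine hB a b (fun x => ?_) h
    rw [form_diagonal_fin_two, re_dotProduct_star_fin_two, mul_add b, ← mul_assoc, ← mul_assoc,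
      Complex.add_re, Complex.re_mul_ofReal, Complex.re_mul_ofReal]
    have := mul_nonneg hα (Complex.normSq_nonneg (x 0))
    have := mul_nonneg hβ (Complex.normSq_nonneg (x 1))
    linarith
  refine .fin_two X₀ X₁ fun h => ⟨(hX h).1, ?_⟩
  rw [← (hX h).2]
  simp

theorem hasCoordinateDilation_diagonal_directSumScalar {α β : ℂ} (μ : ℂ) (B : H →L[ℂ] H)
    (hB : FormDominated (directSumScalar !![α, 0; 0, β] μ) B) :
    HasCoordinateDilation (directSumScalar !![α, 0; 0, β] μ) B := by
  obtain ⟨X₀, X₁, X₂, hX⟩ := exists_decomposition_of_triangle α β μ B fun a b hα hβ hμ h => by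
    refine hB a b (fun x => ?_) h
    rw [form_directSumScalar, re_dotProduct_star_sum, form_diagonal_fin_two,
      re_dotProduct_star_fin_two, mul_add b, mul_add b, ← mul_assoc, ← mul_assoc, ← mul_assoc,
      Complex.add_re, Complex.add_re, Complex.re_mul_ofReal, Complex.re_mul_ofReal,
      Complex.re_mul_ofReal]
    have := mul_nonneg hα (Complex.normSq_nonneg ((x ∘ Sum.inl) 0))
    have := mul_nonneg hβ (Complex.normSq_nonneg ((x ∘ Sum.inl) 1))
    have := mul_nonneg hμ (Complex.normSq_nonneg (x (Sum.inr 0)))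
    linarith
  refine .directSumScalar μ X₀ X₁ X₂ fun h => ⟨(hX h).1, ?_⟩
  rw [← (hX h).2]
  simp

theorem FormDominated.hasCoordinateDilation {A : Matrix (Fin 2) (Fin 2) ℂ} {B : H →L[ℂ] H}
    (hB : FormDominated A B) : HasCoordinateDilation A B := by
  obtain ⟨U, hU, ⟨α, β, h⟩ | ⟨s₀, s₁, o, hne, h⟩⟩ := exists_unitary_diagonal_or_symmetric A
  · have h' := hB.unitary_conj hU
    refine .of_unitary_conj hU ?_
    rw [h] at h' ⊢
    exact hasCoordinateDilation_diagonal B h'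
  · have h' := hB.unitary_conj hU
    refine .of_unitary_conj hU ?_
    rw [h] at h' ⊢
    exact hasCoordinateDilation_symmetric B hne h'

theorem FormDominated.hasCoordinateDilation_directSumScalar {A : Matrix (Fin 2) (Fin 2) ℂ} {μ : ℂ}
    {B : H →L[ℂ] H} (hB : FormDominated (directSumScalar A μ) B) :
    HasCoordinateDilation (directSumScalar A μ) B := by
  obtain ⟨U, hU, hA⟩ := exists_unitary_diagonal_or_symmetric A
  -- The unitary acts on the `2 × 2` block and fixes the coordinate of `μ`.
  have hU' : directSumScalar U 1 * (directSumScalar U 1)ᴴ = 1 := by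
    have h1 : (!![(1 : ℂ)] : Matrix (Fin 1) (Fin 1) ℂ) = 1 := by
      ext i j; fin_cases i; fin_cases j; simp
    rw [directSumScalar, h1, fromBlocks_conjTranspose, fromBlocks_multiply]
    simp [hU]
  have hconj : (directSumScalar U 1)ᴴ * directSumScalar A μ * directSumScalar U 1 =
      directSumScalar (Uᴴ * A * U) μ := by
    have h1 : (!![(1 : ℂ)] : Matrix (Fin 1) (Fin 1) ℂ) = 1 := by
      ext i j; fin_cases i; fin_cases j; simp
    rw [directSumScalar, directSumScalar, directSumScalar, h1, fromBlocks_conjTranspose,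
      fromBlocks_multiply, fromBlocks_multiply]
    simp
  have h' := hB.unitary_conj hU'
  refine .of_unitary_conj hU' ?_
  rw [hconj] at h' ⊢
  obtain ⟨α, β, h⟩ | ⟨s₀, s₁, o, hne, h⟩ := hA
  · rw [h] at h' ⊢
    exact hasCoordinateDilation_diagonal_directSumScalar μ B h'
  · rw [h] at h' ⊢
    exact hasCoordinateDilation_symmetric_directSumScalar B μ hne h'

end Compression

/-! ### From maps and numerical ranges to coordinates, and back. -/

section Interface

universe u v

open Matrix
open scoped ComplexOrder

variable {H : Type u} [NormedAddCommGroup H] [InnerProductSpace ℂ H]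

theorem isPositive_iff_re_im (T : H →L[ℂ] H) :
    T.IsPositive ↔ ∀ x, 0 ≤ (inner ℂ x (T x)).re ∧ (inner ℂ x (T x)).im = 0 := by
  rw [ContinuousLinearMap.isPositive_iff_complex]
  refine forall_congr' fun x => ?_
  rw [← inner_conj_symm (T x) x]
  simp only [RCLike.re_eq_complex_re, Complex.conj_re]
  rw [and_comm]
  refine and_congr_right fun _ => ?_
  rw [Complex.ext_iff]
  simp only [Complex.ofReal_re, Complex.ofReal_im, Complex.conj_re, Complex.conj_im, true_and,
    zero_eq_neg]

theorem inner_blockOp {k : ℕ} (T : Matrix (Fin k) (Fin k) (H →L[ℂ] H))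
    (x : PiLp 2 (fun _ : Fin k => H)) :
    inner ℂ x (blockOp T x) = ∑ p, ∑ q, inner ℂ (x p) (T p q (x q)) := by
  rw [PiLp.inner_apply]
  simp only [blockOp_apply, inner_sum]

theorem isPositiveMap_of_isCompletelyPositiveMap {K : Type v} [NormedAddCommGroup K]
    [InnerProductSpace ℂ K] {S : Submodule ℂ (K →L[ℂ] K)} {Φ : S →ₗ[ℂ] (H →L[ℂ] H)}
    (h : IsCompletelyPositiveMap Φ) : IsPositiveMap Φ := by
  intro T hT
  rw [isPositive_iff_re_im] at hT ⊢
  have h1 := h 1 (Matrix.of fun _ _ => T) (by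
    rw [isPositive_iff_re_im]
    intro x
    simpa [inner_blockOp] using hT (x 0))
  rw [isPositive_iff_re_im] at h1
  intro x
  simpa [inner_blockOp] using h1 (WithLp.toLp 2 fun _ => x)

variable {n : Type} [Fintype n] [DecidableEq n]

theorem inner_matOp (A : Matrix n n ℂ) (x : EuclideanSpace ℂ n) :
    inner ℂ x (matOp A x) = star x.ofLp ⬝ᵥ A *ᵥ x.ofLp := by
  rw [EuclideanSpace.inner_eq_star_dotProduct, ofLp_toEuclideanCLM, dotProduct_comm]

theorem inner_matOp_eq_sum (A : Matrix n n ℂ) (x y : EuclideanSpace ℂ n) :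
    inner ℂ x (matOp A y) = ∑ i, ∑ j, star (x i) * A i j * y j := by
  rw [EuclideanSpace.inner_eq_star_dotProduct, ofLp_toEuclideanCLM, dotProduct_comm]
  simp only [dotProduct, mulVec, Finset.mul_sum, Pi.star_apply, mul_assoc]

theorem adjoint_matOp (A : Matrix n n ℂ) :
    ContinuousLinearMap.adjoint (matOp A) = matOp Aᴴ := by
  rw [← ContinuousLinearMap.star_eq_adjoint, ← Matrix.star_eq_conjTranspose]
  exact (map_star (Matrix.toEuclideanCLM (𝕜 := ℂ) (n := n)) A).symm

theorem star_dotProduct_self_re {m : Type*} [Fintype m] (x : EuclideanSpace ℂ m) :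
    (star x.ofLp ⬝ᵥ x.ofLp).re = ‖x‖ ^ 2 := by
  rw [dotProduct_comm, ← EuclideanSpace.inner_eq_star_dotProduct]
  exact inner_self_eq_norm_sq (𝕜 := ℂ) x

/-- By homogeneity only unit vectors matter, and there the value of the form of `B` is attained by
`A`. -/
theorem FormDominated.of_numericalRange_subset {A : Matrix n n ℂ} {B : H →L[ℂ] H}
    (hAB : numericalRange B ⊆ numericalRange (matOp A)) : FormDominated A B := by
  intro a b hab h
  rcases eq_or_ne h 0 with rfl | hh
  · simp
  have hn : ‖h‖ ≠ 0 := norm_ne_zero_iff.2 hh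
  let w : H := ((‖h‖⁻¹ : ℝ) : ℂ) • h
  have hw : ‖w‖ = 1 := by
    rw [norm_smul, Complex.norm_real, norm_inv, norm_norm, inv_mul_cancel₀ hn]
  obtain ⟨x, hx, hxw⟩ := hAB ⟨w, hw, rfl⟩
  have h1 := hab x.ofLp
  rw [star_dotProduct_self_re, hx, ← inner_matOp, hxw] at h1
  have h2 : inner ℂ h (B h) = ((‖h‖ ^ 2 : ℝ) : ℂ) * inner ℂ w (B w) := by
    have hc : (‖h‖ : ℂ) ≠ 0 := by exact_mod_cast hn
    rw [map_smul, inner_smul_left, inner_smul_right, Complex.conj_ofReal]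
    push_cast
    field_simp
  rw [h2, mul_left_comm, Complex.re_ofReal_mul]
  have := mul_nonneg (sq_nonneg ‖h‖) h1
  linarith

theorem FormDominated.of_isPositiveMap [CompleteSpace H] {A : Matrix n n ℂ} {B : H →L[ℂ] H}
    {Φ : opSystem (matOp A) →ₗ[ℂ] (H →L[ℂ] H)} (hΦ : IsCanonicalMap (matOp A) B Φ)
    (hpos : IsPositiveMap Φ) : FormDominated A B := by
  intro a b hab h
  have hT : (affineRealPart (matOp A) a b).IsPositive := by
    refine ⟨fun x y => isSymmetric_affineRealPart _ a b x y, fun x => ?_⟩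
    rw [reApplyInnerSelf_affineRealPart, inner_matOp, ← star_dotProduct_self_re]
    exact hab _
  have h1 := hpos ⟨affineRealPart (matOp A) a b, combination_mem_opSystem _ _ _ _⟩ hT
  have h2 : Φ ⟨affineRealPart (matOp A) a b, combination_mem_opSystem _ _ _ _⟩ =
      affineRealPart B a b := hΦ _ _ _
  rw [h2] at h1
  rw [← reApplyInnerSelf_affineRealPart]
  exact h1.2 h

/-- A positive semidefinite matrix is a sum of rank-one terms `a a*`, each of which contributes a
squared norm. -/
theorem sum_mul_inner_nonneg_of_posSemidef {K : Type*} [NormedAddCommGroup K] [InnerProductSpace ℂ K]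
    {m : Type*} [Fintype m] {M : Matrix m m ℂ}
    (hM : M.PosSemidef) (w : m → K) :
    0 ≤ (∑ p, ∑ q, M p q * inner ℂ (w p) (w q)).re ∧
      (∑ p, ∑ q, M p q * inner ℂ (w p) (w q)).im = 0 := by
  obtain ⟨r, a, rfl⟩ := Matrix.posSemidef_iff_eq_sum_vecMulVec.1 hM
  have e : ∑ p, ∑ q, (∑ i, vecMulVec (a i) (star (a i))) p q * inner ℂ (w p) (w q) =
      ((∑ i, ‖∑ p, star (a i p) • w p‖ ^ 2 : ℝ) : ℂ) := by
    have e1 : ∀ i, ((‖∑ p, star (a i p) • w p‖ ^ 2 : ℝ) : ℂ) =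
        ∑ p, ∑ q, a i p * star (a i q) * inner ℂ (w p) (w q) := by
      intro i
      rw [← inner_self_re_eq_norm_sq, sum_inner]
      simp only [inner_sum, inner_smul_left, inner_smul_right]
      refine Finset.sum_congr rfl fun p _ => Finset.sum_congr rfl fun q _ => ?_
      simp only [RCLike.star_def, Complex.conj_conj]
      ring
    rw [Complex.ofReal_sum]
    simp only [e1, Matrix.sum_apply, vecMulVec_apply, Pi.star_apply, Finset.sum_mul]
    refine Eq.trans (Finset.sum_congr rfl fun p _ => Finset.sum_comm) Finset.sum_comm
  rw [e]
  exact ⟨by rw [Complex.ofReal_re]; positivity, Complex.ofReal_im _⟩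

section CompressionMap

variable [CompleteSpace H] {K : Type*} [NormedAddCommGroup K] [InnerProductSpace ℂ K]
  [CompleteSpace K]

/-- The completely positive map `M ↦ X* (I ⊗ M) X`, where `X` has coordinates `X i`. -/
noncomputable def compressionMap {m : Type*} [Fintype m] (X : m → H →L[ℂ] K) : Matrix m m ℂ →ₗ[ℂ] (H →L[ℂ] H) where
  toFun M := ∑ i, ∑ j, M i j • (ContinuousLinearMap.adjoint (X i) ∘L X j)
  map_add' M N := by simp [add_smul, Finset.sum_add_distrib]
  map_smul' c M := by simp [mul_smul, Finset.smul_sum]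

theorem inner_compressionMap {m : Type*} [Fintype m] (X : m → H →L[ℂ] K) (M : Matrix m m ℂ) (x y : H) :
    inner ℂ x (compressionMap X M y) = ∑ i, ∑ j, M i j * inner ℂ (X i x) (X j y) := by
  simp [compressionMap, ContinuousLinearMap.adjoint_inner_right]

theorem adjoint_compressionMap {m : Type*} [Fintype m] (X : m → H →L[ℂ] K) (M : Matrix m m ℂ) :
    ContinuousLinearMap.adjoint (compressionMap X M) = compressionMap X Mᴴ := by
  ext y
  refine ext_inner_left ℂ fun x => ?_
  rw [ContinuousLinearMap.adjoint_inner_right, ← inner_conj_symm, inner_compressionMap,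
    inner_compressionMap, Finset.sum_comm]
  simp [map_sum, conjTranspose_apply]

/-- Over the complex numbers an operator is determined by its quadratic form. -/
theorem eq_compressionMap_of_inner_self {m : Type*} [Fintype m] (X : m → H →L[ℂ] K) (M : Matrix m m ℂ) (T : H →L[ℂ] H)
    (h : ∀ x, ∑ i, ∑ j, M i j * inner ℂ (X i x) (X j x) = inner ℂ x (T x)) :
    T = compressionMap X M := by
  refine ContinuousLinearMap.coe_inj.1 ((ext_inner_map _ _).1 fun x => ?_)
  rw [ContinuousLinearMap.coe_coe, ContinuousLinearMap.coe_coe, ← inner_conj_symm, ← h x,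
    ← inner_compressionMap, inner_conj_symm]

end CompressionMap

/-- `Φ` is the restriction of `M ↦ X* (I ⊗ M) X`, which is completely positive. -/
theorem HasCoordinateDilation.isCompletelyPositiveMap [CompleteSpace H] {A : Matrix n n ℂ}
    {B : H →L[ℂ] H} (hAB : HasCoordinateDilation A B)
    {Φ : opSystem (matOp A) →ₗ[ℂ] (H →L[ℂ] H)} (hΦ : IsCanonicalMap (matOp A) B Φ) :
    IsCompletelyPositiveMap Φ := by
  obtain ⟨K, i1, i2, i3, X, hX⟩ := hAB
  have h1 : (1 : H →L[ℂ] H) = compressionMap X 1 :=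
    eq_compressionMap_of_inner_self X 1 1 fun x => by
      simp only [Matrix.one_apply, ite_mul, one_mul, zero_mul, Finset.sum_ite_eq,
        Finset.mem_univ, if_true]
      exact (hX x).1
  have hB : B = compressionMap X A := eq_compressionMap_of_inner_self X A B fun x => (hX x).2
  have key : ∀ T : opSystem (matOp A), ∃ M : Matrix n n ℂ,
      (T : EuclideanSpace ℂ n →L[ℂ] EuclideanSpace ℂ n) = matOp M ∧ Φ T = compressionMap X M := by
    rintro ⟨T, hT⟩
    obtain ⟨a, b, c, habc⟩ := Submodule.mem_span_triple.1 hT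
    subst habc
    refine ⟨a • 1 + b • A + c • Aᴴ, ?_, ?_⟩
    · simp only [map_add, map_smul, map_one, adjoint_matOp]
    · rw [hΦ a b c]
      simp only [map_add, map_smul, ← adjoint_compressionMap, ← h1, ← hB]
  choose M hM hΦM using key
  intro k T hT
  -- The block operator flattened to a scalar matrix on pairs; its positivity is that of the given
  -- block operator.
  let N : Matrix (Fin k × n) (Fin k × n) ℂ := Matrix.of fun p q => M (T p.1 q.1) p.2 q.2
  have hN : N.PosSemidef := by
    rw [← Matrix.isPositive_toEuclideanLin_iff, LinearMap.isPositive_iff_complex]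
    intro x
    have h1 := (isPositive_iff_re_im _).1 hT
      (WithLp.toLp 2 fun p => WithLp.toLp 2 fun i => x.ofLp (p, i))
    have h2 : inner ℂ (Matrix.toEuclideanLin N x) x = (starRingEnd ℂ) (inner ℂ
        (WithLp.toLp 2 fun p => WithLp.toLp 2 fun i => x.ofLp (p, i) :
          PiLp 2 fun _ : Fin k => EuclideanSpace ℂ n)
        (blockOp (T.map fun s => (s : EuclideanSpace ℂ n →L[ℂ] EuclideanSpace ℂ n))
          (WithLp.toLp 2 fun p => WithLp.toLp 2 fun i => x.ofLp (p, i)))) := by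
      rw [← inner_conj_symm, inner_blockOp]
      congr 1
      simp only [Matrix.map_apply, hM, inner_matOp_eq_sum]
      refine (inner_matOp_eq_sum N x x).trans ?_
      simp only [Fintype.sum_prod_type, N, Matrix.of_apply]
      exact Finset.sum_congr rfl fun p _ => Finset.sum_comm
    rw [h2]
    refine ⟨?_, by rw [RCLike.re_eq_complex_re, Complex.conj_re]; exact h1.1⟩
    rw [RCLike.re_eq_complex_re, Complex.conj_re]
    refine Complex.ext ?_ ?_
    · exact (Complex.ofReal_re _).trans (Complex.conj_re _).symm
    · rw [Complex.conj_im, h1.2, neg_zero]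
      exact Complex.ofReal_im _
  rw [isPositive_iff_re_im]
  intro x
  have e : inner ℂ x (blockOp (T.map Φ) x) =
      ∑ p : Fin k × n, ∑ q : Fin k × n, N p q * inner ℂ (X p.2 (x p.1)) (X q.2 (x q.1)) := by
    rw [inner_blockOp]
    simp only [Matrix.map_apply, hΦM, inner_compressionMap, Fintype.sum_prod_type, N,
      Matrix.of_apply]
    refine Finset.sum_congr rfl fun p _ => ?_
    rw [Finset.sum_comm]
  rw [e]
  exact sum_mul_inner_nonneg_of_posSemidef hN _

/-- The isometry is `h ↦ ∑ X i h ⊗ e i`, with `e i` the standard basis. -/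
theorem HasCoordinateDilation.hasTensorDilation [CompleteSpace H] {A : Matrix n n ℂ}
    {B : H →L[ℂ] H} (hAB : HasCoordinateDilation A B) : HasTensorDilation (matOp A) B := by
  obtain ⟨K, i1, i2, i3, X, hX⟩ := hAB
  have hB : B = compressionMap X A := eq_compressionMap_of_inner_self X A B fun x => (hX x).2
  let X' : H →ₗ[ℂ] K ⊗[ℂ] EuclideanSpace ℂ n :=
    ∑ i, ((TensorProduct.mk ℂ K (EuclideanSpace ℂ n)).flip (EuclideanSpace.single i 1)) ∘ₗ
      (X i).toLinearMap
  have hX' : ∀ h, X' h = ∑ i, X i h ⊗ₜ[ℂ] EuclideanSpace.single i (1 : ℂ) := by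
    intro h; simp [X']
  have hiso : ∀ h, ‖X' h‖ = ‖h‖ := by
    intro h
    have : (inner ℂ (X' h) (X' h) : ℂ) = inner ℂ h h := by
      rw [← (hX h).1, hX']
      simp only [sum_inner, inner_sum, TensorProduct.inner_tmul]
      refine Finset.sum_congr rfl fun i _ => ?_
      rw [Finset.sum_eq_single i]
      · simp
      · intro j _ hj
        simp [EuclideanSpace.inner_single_left, hj]
      · simp
    rw [@norm_eq_sqrt_re_inner ℂ, @norm_eq_sqrt_re_inner ℂ _ _ _ _ h, this]
  refine ⟨K, i1, i2, i3, ⟨X', hiso⟩, fun x y => ?_⟩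
  have e : ∀ i j, inner ℂ (EuclideanSpace.single i (1 : ℂ))
      (matOp A (EuclideanSpace.single j (1 : ℂ))) = A i j := by
    intro i j
    rw [EuclideanSpace.inner_single_left, ofLp_toEuclideanCLM]
    simp
  have e2 : inner ℂ x (B y) = ∑ i, ∑ j, A i j * inner ℂ (X i x) (X j y) := by
    rw [hB, inner_compressionMap]
  refine Eq.trans ?_ e2.symm
  change inner ℂ (X' x) ((matOp A).lTensor K (X' y)) = _
  rw [hX', hX', map_sum, sum_inner]
  simp only [inner_sum]
  refine Finset.sum_congr rfl fun i _ => Finset.sum_congr rfl fun j _ => ?_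
  have e3 : (matOp A).lTensor K (X j y ⊗ₜ[ℂ] EuclideanSpace.single j (1 : ℂ)) =
      X j y ⊗ₜ[ℂ] matOp A (EuclideanSpace.single j (1 : ℂ)) := rfl
  rw [e3, TensorProduct.inner_tmul, e, mul_comm]

end Interface

theorem theorem2p1 {H : Type*} [NormedAddCommGroup H] [InnerProductSpace ℂ H] [CompleteSpace H]
    (A₀ : Matrix (Fin 2) (Fin 2) ℂ) (B : H →L[ℂ] H) :
    -- the case `A = A₀`
    ((∀ Φ : opSystem (matOp A₀) →ₗ[ℂ] (H →L[ℂ] H),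
        IsCanonicalMap (matOp A₀) B Φ → (IsPositiveMap Φ ↔ IsCompletelyPositiveMap Φ)) ∧
      (numericalRange B ⊆ numericalRange (matOp A₀) → HasTensorDilation (matOp A₀) B)) ∧
    -- the case `A = A₀ ⊕ [μ]`
    (∀ μ : ℂ,
      (∀ Φ : opSystem (matOp (directSumScalar A₀ μ)) →ₗ[ℂ] (H →L[ℂ] H),
        IsCanonicalMap (matOp (directSumScalar A₀ μ)) B Φ →
          (IsPositiveMap Φ ↔ IsCompletelyPositiveMap Φ)) ∧
      (numericalRange B ⊆ numericalRange (matOp (directSumScalar A₀ μ)) →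
        HasTensorDilation (matOp (directSumScalar A₀ μ)) B)) := by
  refine ⟨⟨fun Φ hΦ => ⟨fun h => ?_, fun h => isPositiveMap_of_isCompletelyPositiveMap h⟩, fun h => ?_⟩,
    fun μ => ⟨fun Φ hΦ => ⟨fun h => ?_, fun h => isPositiveMap_of_isCompletelyPositiveMap h⟩, fun h => ?_⟩⟩
  · exact (FormDominated.of_isPositiveMap hΦ h).hasCoordinateDilation.isCompletelyPositiveMap hΦ
  · exact (FormDominated.of_numericalRange_subset h).hasCoordinateDilation.hasTensorDilation
  · exact (FormDominated.of_isPositiveMap hΦ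
      h).hasCoordinateDilation_directSumScalar.isCompletelyPositiveMap hΦ
  · exact (FormDominated.of_numericalRange_subset
      h).hasCoordinateDilation_directSumScalar.hasTensorDilation
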